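/- **Theorem.** Let $n>0$, let $S=\{s_1,\dots,s_{n-1}\}$ with $s_i=(i,i+1)$ be the set of adjacent transpositions of $\mathfrak S_n$, and let $J\subseteq S$. *Definitions.* Writing $S\setminus J=\{s_{j_1},\dots,s_{j_r}\}$ with $j_1<\dots<j_r$, the *$J$-regions* are $R_0=\{1,\dots,j_1\}$, $R_1=\{j_1+1,\dots,j_2\},\ \dots,\ R_r=\{j_r+1,\dots,n\}$. * $\mathfrak S_n^J$ is the set of $w\in\mathfrak S_n$ such that $w_i>w_{i+1}$ implies $s_i\notin J$. Put $\mathrm{des}(w)=\{(i,j): i<j,\ w_i=w_j+1\}$. The set $\mathfrak S_n^J(231)$ consists of the $w\in\mathfrak S_n^J$ for which there are no $i<j<k$ in three different $J$-regions with $w_k<w_i<w_j$ and $w_i=w_k+1$. * A *bump* of a set partition $\mathbf P$ of $[n]$ is a pair $(a,b)$ with $a<b$ in a common part that has no element $c$ with $a<c<b$. Let $\mathrm{NC}_n^J$ be the set of set partitions $\mathbf P$ of $[n]$ such that (NC1) two distinct elements of one $J$-region are never in the same part; (NC2) if $(i_1,i_2),(j_1,j_2)$ are bumps with $i_1<j_1<i_2<j_2$,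 then $i_1,j_1$ or $i_2,j_1$ are in the same $J$-region; (NC3) if $(i_1,i_2),(j_1,j_2)$ are bumps with $i_1<j_1<j_2<i_2$, then $i_1,j_1$ are in different $J$-regions. * $\mathrm{NN}_n^J$ is the set of set partitions of $[n]$ that satisfy (NC1) and have no two bumps $(i_1,i_2),(j_1,j_2)$ with $i_1<j_1<j_2<i_2$. * $\Phi_+^J$ is the set of pairs $(i,j)$, $1\le i<j\le n$, such that $i\le a<a+1\le j$ for some $s_a\notin J$, ordered by $(i_1,i_2)\le(j_1,j_2)$ iff $i_1\ge j_1$ and $i_2\le j_2$. * *The recursive word.* For $\mathbf P\in\mathrm{NC}_n^J$, let $\preceq$ be the reflexive and transitive closure of the relation on parts in which $B$ is related to $B'$ if some bump $(i_1,i_2)$ with $i_1,i_2\in B$ satisfies $i_1<\min B'<i_2$, with $i_1$ and $\min B'$ in different $J$-regions. For a union $A\neq\emptyset$ of parts, let $\bar P$ be the part containing $\min A$ and $X$ the union of the parts $B\subseteq A$ with $\bar P\preceq B$. Define $u^A\colon A\to\mathbb N$ recursively: on $\bar P$ it takes the values $|X|,|X|-1,\dots$ from left to right; on $X\setminus\bar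 P$ it equals $u^{X\setminus\bar P}$; on $A\setminus X$ it equals $|X|+u^{A\setminus X}$. * *The inductive bump set.* For an order ideal $I$ of $\Phi_+^J$ define, for $m=r-1,r-2,\dots,0$: let $T_m$ be the set of $j$ with $(\min R_{m+1},j)\in I$; let $C_m=R_{m+1}\cup T_m$ (the chosen columns); let $L_m=R_{m+1}\cup\ell_{m+1}(T_m)$ (the available labels); and let $\ell_m\colon C_m\to L_m$ be the order-reversing bijection. (For $m=r-1$ we have $T_m=\emptyset$.) Let $\rho_m$ be the order-reversing bijection of $R_m$, and let $\beta(I)$ be the set of all pairs $(\rho_m(i),\ell_m(j))$, for $0\le m<r$ and $(i,j)$ a minimal element of $\{(i,j)\in\Phi_+^J\setminus I: i\in R_m,\ j\in C_m\}$. *Claim.* There are bijections $$\varphi\colon\mathfrak S_n^J(231)\to \mathrm{NC}_n^J,\qquad \psi\colon \mathrm{NC}_n^J\to \mathrm{NN}_n^J,\qquad \iota\colon\mathrm{NN}_n^J\to\{\text{order ideals of }\Phi_+^J\}$$ such that 1. for every $w\in\mathfrak S_n^J(231)$, the set of bumps of $\varphi(w)$ is $\mathrm{des}(w)$; 2. for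 every $\mathbf P\in\mathrm{NC}_n^J$, the permutation $\varphi^{-1}(\mathbf P)$ has one-line notation $u^{[n]}(1)\,u^{[n]}(2)\cdots u^{[n]}(n)$; 3. for every $\mathbf Q\in\mathrm{NN}_n^J$, the bumps of $\mathbf Q$ are the minimal elements of $\Phi_+^J\setminus\iota(\mathbf Q)$; 4. for every $\mathbf Q\in\mathrm{NN}_n^J$, the set of bumps of $\psi^{-1}(\mathbf Q)$ is $\beta(\iota(\mathbf Q))$. -/

import Mathlib

namespace ParabolicCatalan

open Finset
open scoped Classical

/-! The set `[n] = {1, …, n}` is modelled by `Fin n`, so position or value `i` of `[n]`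
is `i - 1` in `Fin n`. A permutation `w` has one-line notation `w 0, w 1, …`. -/

/-- The set `S` of adjacent transpositions of the symmetric group. -/
def adjacentTranspositions (n : ℕ) : Set (Equiv.Perm (Fin n)) :=
  {s | ∃ a b : Fin n, a.val + 1 = b.val ∧ s = Equiv.swap a b}

section
variable {n : ℕ} (J : Set (Equiv.Perm (Fin n)))

/-- The number of cuts `a | a+1` (that is, adjacent transpositions `(a, a+1)` not in `J`)
with `a + 1 ≤ i`. It numbers the `J`-regions `0, 1, 2, …` from left to right. -/
noncomputable def regionIndex (i : Fin n) : ℕ :=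
  #{b : Fin n | b ≤ i ∧ ∃ a : Fin n, a.val + 1 = b.val ∧ Equiv.swap a b ∉ J}

/-- `i` and `j` lie in the same `J`-region. -/
def SameRegion (i j : Fin n) : Prop := regionIndex J i = regionIndex J j

/-- The `m`-th `J`-region (empty if there are not that many regions). -/
noncomputable def region (m : ℕ) : Finset (Fin n) := {i | regionIndex J i = m}

/-! ### Permutations -/

/-- The parabolic quotient: permutations with descents only at positions not in `J`. -/
def parabolicQuotient : Set (Equiv.Perm (Fin n)) :=
  {w | ∀ a b : Fin n, a.val + 1 = b.val → w b < w a → Equiv.swap a b ∉ J}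

/-- `w` contains a `(J, 231)`-pattern. -/
def ContainsPattern (w : Equiv.Perm (Fin n)) : Prop :=
  ∃ i j k : Fin n, i < j ∧ j < k ∧
    ¬ SameRegion J i j ∧ ¬ SameRegion J j k ∧ ¬ SameRegion J i k ∧
    w k < w i ∧ w i < w j ∧ (w i).val = (w k).val + 1

/-- The set of `(J, 231)`-avoiding permutations of the parabolic quotient. -/
def avoiding231 : Set (Equiv.Perm (Fin n)) :=
  {w | w ∈ parabolicQuotient J ∧ ¬ ContainsPattern J w}

/-- The descent set of `w`: inversions `(i, j)` (pairs of positions) whose values are consecutive. -/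
def des (w : Equiv.Perm (Fin n)) : Set (Fin n × Fin n) :=
  {p | p.1 < p.2 ∧ w p.2 < w p.1 ∧ (w p.1).val = (w p.2).val + 1}

/-! ### Set partitions -/

/-- The bumps of a set partition: pairs `a < b` of consecutive elements of a part. -/
def bumps (P : Finpartition (univ : Finset (Fin n))) : Set (Fin n × Fin n) :=
  {p | p.1 < p.2 ∧ ∃ B ∈ P.parts, p.1 ∈ B ∧ p.2 ∈ B ∧ ∀ c ∈ B, ¬ (p.1 < c ∧ c < p.2)}

/-- No part of `P` contains two distinct elements of one `J`-region. -/
def Transversal (P : Finpartition (univ : Finset (Fin n))) : Prop :=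
  ∀ i j : Fin n, i ≠ j → SameRegion J i j → ∀ B ∈ P.parts, ¬ (i ∈ B ∧ j ∈ B)

/-- The set of `J`-noncrossing partitions. -/
def noncrossing : Set (Finpartition (univ : Finset (Fin n))) :=
  {P | Transversal J P ∧
    (∀ i₁ i₂ j₁ j₂ : Fin n, (i₁, i₂) ∈ bumps P → (j₁, j₂) ∈ bumps P →
      i₁ < j₁ → j₁ < i₂ → i₂ < j₂ → SameRegion J i₁ j₁ ∨ SameRegion J i₂ j₁) ∧
    (∀ i₁ i₂ j₁ j₂ : Fin n, (i₁, i₂) ∈ bumps P → (j₁, j₂) ∈ bumps P →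
      i₁ < j₁ → j₁ < j₂ → j₂ < i₂ → ¬ SameRegion J i₁ j₁)}

/-- The set of `J`-nonnesting partitions. -/
def nonnesting : Set (Finpartition (univ : Finset (Fin n))) :=
  {P | Transversal J P ∧
    ∀ i₁ i₂ j₁ j₂ : Fin n, (i₁, i₂) ∈ bumps P → (j₁, j₂) ∈ bumps P →
      ¬ (i₁ < j₁ ∧ j₁ < j₂ ∧ j₂ < i₂)}

/-! ### The recursive construction of a permutation from a noncrossing partition -/

/-- The generating relation on parts: some bump `(i₁, i₂)` of `B` passes over `min B'`,
where `min B'` is not in the `J`-region of `i₁`. -/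
def PartRel (P : Finpartition (univ : Finset (Fin n))) (B B' : Finset (Fin n)) : Prop :=
  B ∈ P.parts ∧ B' ∈ P.parts ∧
    ∃ i₁ i₂ m : Fin n, (i₁, i₂) ∈ bumps P ∧ i₁ ∈ B ∧ i₂ ∈ B ∧
      IsLeast (B' : Set (Fin n)) m ∧ i₁ < m ∧ m < i₂ ∧ ¬ SameRegion J i₁ m

/-- The elements of `A` that belong to parts in the order filter generated by the part of `a`,
in the reflexive and transitive closure of `PartRel`. -/
noncomputable def partFilter (P : Finpartition (univ : Finset (Fin n))) (A : Finset (Fin n))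
    (a : Fin n) : Finset (Fin n) :=
  {x ∈ A | Relation.ReflTransGen (PartRel J P) (P.part a) (P.part x)}

/-- The one-line notation (with values `1, …, |A|`) built recursively on a union `A` of parts of `P`.
Let `P̄` be the part of `min A` and `X` the set of elements of `A` lying in parts of
the order filter generated by `P̄`. The positions in `P̄` get, from left to right, the values
`|X|, |X| - 1, …`; the positions in `X \ P̄` get the values of the word built on `X \ P̄`, and those in
`A \ X` get the values of the word built on `A \ X`, increased by `|X|`. -/
noncomputable def recursiveWord (P : Finpartition (univ : Finset (Fin n)))
    (A : Finset (Fin n)) (j : Fin n) : ℕ :=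
  if h : A.Nonempty then
    if j ∈ P.part (A.min' h) then
      #(partFilter J P A (A.min' h)) - #{c ∈ P.part (A.min' h) | c < j}
    else if j ∈ partFilter J P A (A.min' h) then
      recursiveWord P (partFilter J P A (A.min' h) \ P.part (A.min' h)) j
    else
      #(partFilter J P A (A.min' h)) + recursiveWord P (A \ partFilter J P A (A.min' h)) j
  else 0
termination_by #A
decreasing_by
  all_goals
    apply Finset.card_lt_card
    rw [Finset.ssubset_iff_of_subset]
    · refine ⟨A.min' h, A.min'_mem h, ?_⟩
      have h1 : A.min' h ∈ P.part (A.min' h) := P.mem_part (mem_univ _)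
      have h2 : A.min' h ∈ partFilter J P A (A.min' h) := by
        simp only [partFilter, mem_filter]
        exact ⟨A.min'_mem h, Relation.ReflTransGen.refl⟩
      simp [h1, h2]
    · intro x hx
      simp only [partFilter, mem_sdiff, mem_filter] at hx
      tauto

end

/-! ### Order ideals of the parabolic root poset -/

/-- The transpositions `(fst, snd)` with `fst < snd`, the elements of the root poset. -/
@[ext]
structure Root (n : ℕ) where
  fst : Fin n
  snd : Fin n
  lt : fst < snd

/-- The order of the root poset: `(i₁, i₂) ≤ (j₁, j₂)` iff `i₁ ≥ j₁` and `i₂ ≤ j₂`. -/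
instance (n : ℕ) : PartialOrder (Root n) where
  le s t := t.fst ≤ s.fst ∧ s.snd ≤ t.snd
  le_refl s := ⟨le_refl _, le_refl _⟩
  le_trans s t u h k := ⟨k.1.trans h.1, h.2.trans k.2⟩
  le_antisymm s t h k := Root.ext (le_antisymm k.1 h.1) (le_antisymm h.2 k.2)

section
variable {n : ℕ} (J : Set (Equiv.Perm (Fin n)))

/-- The order filter of the root poset generated by the adjacent transpositions not in `J`. -/
def parabolicRoots : Set (Root n) :=
  {t | ∃ s : Root n, s.fst.val + 1 = s.snd.val ∧ Equiv.swap s.fst s.snd ∉ J ∧ s ≤ t}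

/-- The parabolic root poset, with the induced order. -/
abbrev ParabolicRoot : Type := ↥(parabolicRoots J)

variable {J}

/-- The minimal elements of the complement of an order ideal `I`, as pairs. -/
def minimalComplement (I : LowerSet (ParabolicRoot J)) : Set (Fin n × Fin n) :=
  {p | ∃ t : ParabolicRoot J, Minimal (fun s => s ∉ I) t ∧ p = (t.1.fst, t.1.snd)}

/-! ### The inductive construction of a noncrossing partition from an order ideal -/

/-- The order-reversing matching from `C` to `L` (finite sets of equal size):
the `k`-th smallest element of `C` goes to the `k`-th largest element of `L`. -/
noncomputable def reverseMatch (C L : Finset (Fin n)) (j : Fin n) : Fin n :=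
  (L.sort (fun a b => b ≤ a)).getD #{c ∈ C | c < j} j

/-- The columns `j` for which the order ideal `I` contains `(b, j)`, where `b` is the first element
of the `J`-region number `m + 1`. -/
noncomputable def supported (I : LowerSet (ParabolicRoot J)) (m : ℕ) : Finset (Fin n) :=
  {j | ∃ b : Fin n, IsLeast (region J (m + 1) : Set (Fin n)) b ∧
    ∃ t ∈ I, t.1.fst = b ∧ t.1.snd = j}

/-- The chosen columns above the rows of region `m`: those of region `m + 1`, and those supported by
the part of `I` in the rows of later regions. -/
noncomputable def chosenColumns (I : LowerSet (ParabolicRoot J)) (m : ℕ) : Finset (Fin n) :=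
  region J (m + 1) ∪ supported I m

/-- The label of the column `j` above the rows of region `m`. The available labels are the elements of
region `m + 1`, and the labels that the supported columns have above region `m + 1`;
they are assigned to the chosen columns in reversed order. -/
noncomputable def columnLabel (I : LowerSet (ParabolicRoot J)) (m : ℕ) (j : Fin n) : Fin n :=
  if m < n then
    reverseMatch (chosenColumns I m)
      (region J (m + 1) ∪ (supported I m).image (columnLabel I (m + 1))) j
  else j
termination_by n - m

/-- The bumps that start in the `J`-regions `m, m + 1, …`: those built from the later regions, together with
the labels of the minimal transpositions not in `I` within the rows of
region `m` and the chosen columns. The rows of region `m` are labelled in reversed order. -/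
noncomputable def idealBumpsFrom (I : LowerSet (ParabolicRoot J)) (m : ℕ) : Set (Fin n × Fin n) :=
  if m < n then
    idealBumpsFrom I (m + 1) ∪
      {p | ∃ t : ParabolicRoot J,
        Minimal (fun s : ParabolicRoot J =>
          s ∉ I ∧ s.1.fst ∈ region J m ∧ s.1.snd ∈ chosenColumns I m) t ∧
        p = (reverseMatch (region J m) (region J m) t.1.fst, columnLabel I m t.1.snd)}
  else ∅
termination_by n - m

/-- The bumps of the noncrossing partition built from the order ideal `I`. -/
noncomputable def idealBumps (I : LowerSet (ParabolicRoot J)) : Set (Fin n × Fin n) :=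
  idealBumpsFrom I 0

end

end ParabolicCatalan

/-!
All four families are encoded by sets of pairs `(a, b)` in which no two pairs share a left end or a
right end: such a set is the bump set of exactly one set partition (`exists_bumps_eq`,
`bumps_injective`). So each bijection amounts to saying which sets of pairs occur.

*Permutations.* In an avoiding permutation `w` with a descent `(i, k)`, each position `m` between `i`
and `k` outside the region of `i` has `w m < w i`: either `m` is in the region of `k`, where `w`
increases, or avoidance applies (`lt_of_mem_des`). This gives the noncrossing conditions for the
partition with bumps `des w`. It also shows that on a union `A` of parts with an interval of values,
the elements with values at most that of `a = min A` are exactly those in parts above the part of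
`a`: the smallest value greater than that of a later part and taken to the left of that part starts
a descent over its minimum (`reflTransGen_partRel_of_le`). Hence `w` is the recursive word of its
partition. Conversely, for a noncrossing partition, a part with an element `m` under a bump `(p, q)`,
with `p` and `m` in different regions, is above the part of `p` or reaches to the left of `p` inside
the region of `p` (`partRel_or_exists`). By induction, the order on parts is compatible with the
order inside the regions (`reflTransGen_of_sameRegion`), so the recursive word increases in each
region; its descents are the bumps, and it avoids the pattern.

*Nonnesting partitions.* Their bump sets are the antichains of the root poset, and an antichain is
the set of minimal elements of the complement of a unique order ideal.

*Order ideals.* In the rows of region `m`, the ideal `I` lives in the chosen columns, an interval that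
depends only on the rows of the later regions, and `I` is determined there by its corners, an
antichain. The labellings of rows and columns both reverse the order, so the labelled corners are an
arbitrary non-nesting partial matching from region `m` into the available labels. The available labels are
exactly the elements that a bump from region `m` may end in without crossing the later bumps in a
forbidden way (`mem_labels_iff`), because the columns before all corners of region `m + 1` carry the
labels greater than the ends of all its bumps. Downward induction over the regions then shows that
`I ↦ idealBumps I` is injective and that its values are the bump sets of the noncrossing partitions.
-/

namespace ParabolicCatalan

open Finset Relation
open scoped Classical

/-! ### Regions -/

section
variable {n : ℕ} {J : Set (Equiv.Perm (Fin n))}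

theorem regionIndex_mono {i j : Fin n} (h : i ≤ j) : regionIndex J i ≤ regionIndex J j :=
  card_le_card fun _ hb => by
    simp only [mem_filter, mem_univ, true_and] at hb ⊢
    exact ⟨hb.1.trans h, hb.2⟩

theorem lt_of_regionIndex_lt {i j : Fin n} (h : regionIndex J i < regionIndex J j) : i < j := by
  by_contra hij
  exact absurd (regionIndex_mono (J := J) (not_lt.1 hij)) (not_le.2 h)

theorem regionIndex_lt_iff {i j : Fin n} : regionIndex J i < regionIndex J j ↔
    ∃ b : Fin n, i < b ∧ b ≤ j ∧ ∃ a : Fin n, a.val + 1 = b.val ∧ Equiv.swap a b ∉ J := by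
  constructor
  · intro h
    by_contra hne
    refine absurd h (not_lt.2 (card_le_card fun b hb => ?_))
    simp only [mem_filter, mem_univ, true_and] at hb ⊢
    refine ⟨?_, hb.2⟩
    by_contra hbi
    exact hne ⟨b, not_le.1 hbi, hb⟩
  · rintro ⟨b, hib, hbj, hb⟩
    refine card_lt_card ((ssubset_iff_of_subset ?_).2 ⟨b, ?_, ?_⟩)
    · intro c hc
      simp only [mem_filter, mem_univ, true_and] at hc ⊢
      exact ⟨hc.1.trans (hib.le.trans hbj), hc.2⟩
    · simp only [mem_filter, mem_univ, true_and]
      exact ⟨hbj, hb⟩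
    · simp only [mem_filter, mem_univ, true_and, not_and]
      exact fun h => absurd hib (not_lt.2 h)

theorem not_sameRegion_iff {i j : Fin n} (h : i ≤ j) :
    ¬ SameRegion J i j ↔ regionIndex J i < regionIndex J j :=
  ⟨fun hn => lt_of_le_of_ne (regionIndex_mono h) hn, fun hlt => ne_of_lt hlt⟩

theorem SameRegion.symm {i j : Fin n} (h : SameRegion J i j) : SameRegion J j i :=
  Eq.symm h

theorem SameRegion.trans {i j k : Fin n} (h : SameRegion J i j) (h' : SameRegion J j k) :
    SameRegion J i k :=
  Eq.trans h h'

/-- Regions are intervals. -/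
theorem SameRegion.between {i j k : Fin n} (h : SameRegion J i k) (hij : i ≤ j) (hjk : j ≤ k) :
    SameRegion J i j :=
  le_antisymm (regionIndex_mono hij) ((regionIndex_mono hjk).trans (le_of_eq (Eq.symm h)))

theorem SameRegion.between_right {i j k : Fin n} (h : SameRegion J i k) (hij : i ≤ j)
    (hjk : j ≤ k) : SameRegion J j k :=
  (h.between hij hjk).symm.trans h

/-- The first element of region `m` exists as soon as some later region is nonempty. -/
theorem exists_isLeast_region {m : ℕ} {l : Fin n} (h : m ≤ regionIndex J l) :
    ∃ b ≤ l, IsLeast (region J m : Set (Fin n)) b := by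
  have key : ∀ k : ℕ, ∀ l : Fin n, l.val = k → m ≤ regionIndex J l →
      ∃ b ≤ l, regionIndex J b = m := by
    intro k
    induction k with
    | zero =>
      intro l hl hm
      refine ⟨l, le_rfl, le_antisymm ?_ hm⟩
      have : regionIndex J l = 0 := by
        rw [regionIndex, card_eq_zero, filter_eq_empty_iff]
        rintro b - ⟨hb, a, ha, -⟩
        have := Fin.le_def.1 hb
        omega
      omega
    | succ k ih =>
      intro l hl hm
      have hk : k < n := by have := l.2; omega
      by_cases hc : m ≤ regionIndex J (⟨k, hk⟩ : Fin n)
      · obtain ⟨b, hb, hbm⟩ := ih ⟨k, hk⟩ rfl hc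
        exact ⟨b, hb.trans (Fin.le_def.2 (by simp; omega)), hbm⟩
      · refine ⟨l, le_rfl, le_antisymm ?_ hm⟩
        have hle : regionIndex J l ≤ regionIndex J (⟨k, hk⟩ : Fin n) + 1 := by
          rw [regionIndex, regionIndex]
          refine (card_le_card (t := insert l _) fun b hb => ?_).trans (card_insert_le _ _)
          simp only [mem_filter, mem_univ, true_and, mem_insert] at hb ⊢
          rcases eq_or_lt_of_le hb.1 with h | h
          · exact Or.inl h
          · exact Or.inr ⟨Fin.le_def.2 (by have := Fin.lt_def.1 h; simp; omega), hb.2⟩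
        omega
  obtain ⟨b, hbl, hb⟩ := key _ l rfl h
  have hne : (region J m).Nonempty := ⟨b, by simp [region, hb]⟩
  refine ⟨(region J m).min' hne, ((region J m).min'_le b (by simp [region, hb])).trans hbl, ?_⟩
  exact (region J m).isLeast_min' hne

theorem mem_region {m : ℕ} {i : Fin n} : i ∈ region J m ↔ regionIndex J i = m := by
  simp [region]

theorem mem_parabolicRoots_iff {t : Root n} :
    t ∈ parabolicRoots J ↔ ¬ SameRegion J t.fst t.snd := by
  rw [not_sameRegion_iff t.lt.le, regionIndex_lt_iff]
  constructor
  · rintro ⟨s, hs, hJ, h1, h2⟩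
    exact ⟨s.snd, lt_of_le_of_lt h1 s.lt, h2, s.fst, hs, hJ⟩
  · rintro ⟨b, hb1, hb2, a, hab, hJ⟩
    refine ⟨⟨a, b, Fin.lt_def.2 (by omega)⟩, hab, hJ, Fin.le_def.2 ?_, hb2⟩
    have := Fin.lt_def.1 hb1
    simp only
    omega

theorem mem_parabolicQuotient_iff {w : Equiv.Perm (Fin n)} :
    w ∈ parabolicQuotient J ↔ ∀ x y : Fin n, x < y → SameRegion J x y → w x < w y := by
  constructor
  · intro hw x y hxy hs
    have key : ∀ k : ℕ, ∀ y : Fin n, y.val = x.val + 1 + k → SameRegion J x y → w x < w y := by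
      intro k
      induction k with
      | zero =>
        intro y hy hs
        by_contra hlt
        have hxy : x < y := Fin.lt_def.2 (by omega)
        have hlt' : w y < w x := lt_of_le_of_ne (not_lt.1 hlt) fun h => hxy.ne' (w.injective h)
        have hJ := hw x y (by omega) hlt'
        exact absurd hs ((not_sameRegion_iff hxy.le).2
          (regionIndex_lt_iff.2 ⟨y, hxy, le_rfl, x, by omega, hJ⟩))
      | succ k ih =>
        intro y hy hs
        have hy2 := y.2
        let z : Fin n := ⟨x.val + 1 + k, by omega⟩
        have hxz : x ≤ z := Fin.le_def.2 (by simp [z]; omega)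
        have hzy : z < y := Fin.lt_def.2 (by simp [z]; omega)
        refine (ih z rfl (hs.between hxz hzy.le)).trans ?_
        by_contra hlt
        have hlt' : w y < w z := lt_of_le_of_ne (not_lt.1 hlt) fun h => hzy.ne' (w.injective h)
        have hJ := hw z y (by simp [z]; omega) hlt'
        exact absurd (hs.between_right hxz hzy.le) ((not_sameRegion_iff hzy.le).2
          (regionIndex_lt_iff.2 ⟨y, hzy, le_rfl, z, by simp [z]; omega, hJ⟩))
    have := Fin.lt_def.1 hxy
    exact key (y.val - x.val - 1) y (by omega) hs
  · intro h a b hab hlt hJ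
    have hab' : a < b := Fin.lt_def.2 (by omega)
    refine absurd (h a b hab' ?_) (not_lt.2 hlt.le)
    by_contra hs
    obtain ⟨c, hac, hcb, d, hdc, hdJ⟩ := regionIndex_lt_iff.1 ((not_sameRegion_iff hab'.le).1 hs)
    have h1 := Fin.lt_def.1 hac
    have h2 := Fin.le_def.1 hcb
    obtain rfl : c = b := Fin.ext (by omega)
    obtain rfl : d = a := Fin.ext (by omega)
    exact hdJ hJ

end

/-! ### Set partitions and their bumps -/

section
variable {n : ℕ} {P Q : Finpartition (univ : Finset (Fin n))}

theorem mem_part_iff {a b : Fin n} : a ∈ P.part b ↔ P.part a = P.part b :=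
  P.mem_part_iff_part_eq_part (mem_univ _) (mem_univ _)

theorem mem_bumps_iff {a b : Fin n} : (a, b) ∈ bumps P ↔
    a < b ∧ P.part a = P.part b ∧ ∀ c, P.part c = P.part a → ¬ (a < c ∧ c < b) := by
  constructor
  · rintro ⟨hab, B, hB, ha, hb, hc⟩
    have h1 := P.part_eq_of_mem hB ha
    refine ⟨hab, h1.trans (P.part_eq_of_mem hB hb).symm, fun c hcc => hc c ?_⟩
    exact (P.part_eq_iff_mem hB).1 (hcc.trans h1)
  · rintro ⟨hab, he, hc⟩
    exact ⟨hab, P.part a, P.part_mem.2 (mem_univ _), mem_part_iff.2 rfl, mem_part_iff.2 he.symm,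
      fun c hcm => hc c (mem_part_iff.1 hcm)⟩

theorem bumps_lt {a b : Fin n} (h : (a, b) ∈ bumps P) : a < b := h.1

theorem bumps_part {a b : Fin n} (h : (a, b) ∈ bumps P) : P.part a = P.part b :=
  (mem_bumps_iff.1 h).2.1

theorem bumps_part_ne {a b c : Fin n} (h : (a, b) ∈ bumps P) (hac : a < c) (hcb : c < b) :
    P.part c ≠ P.part a :=
  fun he => (mem_bumps_iff.1 h).2.2 c he ⟨hac, hcb⟩

theorem bumps_right_unique {a b b' : Fin n} (h : (a, b) ∈ bumps P) (h' : (a, b') ∈ bumps P) :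
    b = b' := by
  rcases lt_trichotomy b b' with hlt | rfl | hlt
  · exact absurd (bumps_part h).symm (bumps_part_ne h' (bumps_lt h) hlt)
  · rfl
  · exact absurd (bumps_part h').symm (bumps_part_ne h (bumps_lt h') hlt)

theorem bumps_left_unique {a a' b : Fin n} (h : (a, b) ∈ bumps P) (h' : (a', b) ∈ bumps P) :
    a = a' := by
  have he : P.part a = P.part a' := (bumps_part h).trans (bumps_part h').symm
  rcases lt_trichotomy a a' with hlt | rfl | hlt
  · exact absurd he.symm (bumps_part_ne h hlt (bumps_lt h'))
  · rfl
  · exact absurd he (bumps_part_ne h' hlt (bumps_lt h))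

theorem exists_bump_right {a b : Fin n} (hab : a < b) (h : P.part a = P.part b) :
    ∃ c ≤ b, (a, c) ∈ bumps P := by
  have hne : ({c | a < c ∧ P.part c = P.part a} : Finset (Fin n)).Nonempty :=
    ⟨b, by simp [hab, h]⟩
  have hmem := Finset.min'_mem _ hne
  simp only [mem_filter, mem_univ, true_and] at hmem
  refine ⟨_, Finset.min'_le _ b (by simp [hab, h]), mem_bumps_iff.2 ⟨hmem.1, hmem.2.symm, ?_⟩⟩
  rintro c hc ⟨h1, h2⟩
  exact absurd (Finset.min'_le _ c (by simp [h1, hc])) (not_le.2 h2)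

theorem exists_bump_left {a b : Fin n} (hab : a < b) (h : P.part a = P.part b) :
    ∃ c, a ≤ c ∧ (c, b) ∈ bumps P := by
  have hne : ({c | c < b ∧ P.part c = P.part b} : Finset (Fin n)).Nonempty :=
    ⟨a, by simp [hab, h]⟩
  have hmem := Finset.max'_mem _ hne
  simp only [mem_filter, mem_univ, true_and] at hmem
  refine ⟨_, Finset.le_max' _ a (by simp [hab, h]), mem_bumps_iff.2 ⟨hmem.1, hmem.2, ?_⟩⟩
  rintro c hc ⟨h1, h2⟩
  exact absurd (Finset.le_max' _ c (by simp [h2, hc.trans hmem.2])) (not_le.2 h1)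

theorem bumps_injective : Function.Injective (bumps (n := n)) := by
  have key : ∀ P Q : Finpartition (univ : Finset (Fin n)), bumps P = bumps Q →
      ∀ b a : Fin n, a ≤ b → P.part a = P.part b → Q.part a = Q.part b := by
    intro P Q h b
    induction b using WellFoundedLT.induction with
    | _ b ih =>
    intro a hab he
    rcases eq_or_lt_of_le hab with rfl | hlt
    · rfl
    · obtain ⟨c, hac, hc⟩ := exists_bump_left hlt he
      have hc' := hc
      rw [h] at hc'
      exact (ih c (bumps_lt hc) a hac (he.trans (bumps_part hc).symm)).trans (bumps_part hc')
  have key' : ∀ P Q : Finpartition (univ : Finset (Fin n)), bumps P = bumps Q →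
      ∀ a b : Fin n, P.part a = P.part b → Q.part a = Q.part b := by
    intro P Q h a b he
    rcases le_total a b with hab | hab
    · exact key P Q h b a hab he
    · exact (key P Q h a b hab he.symm).symm
  have hparts : ∀ P Q : Finpartition (univ : Finset (Fin n)), bumps P = bumps Q →
      P.parts ⊆ Q.parts := by
    intro P Q h B hB
    obtain ⟨a, ha⟩ := P.nonempty_of_mem_parts hB
    have : B = Q.part a := by
      rw [← P.part_eq_of_mem hB ha]
      ext x
      rw [mem_part_iff, mem_part_iff]
      exact ⟨key' P Q h x a, key' Q P h.symm x a⟩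
    rw [this]
    exact Q.part_mem.2 (mem_univ _)
  intro P Q h
  exact Finpartition.ext ((hparts P Q h).antisymm (hparts Q P h.symm))

/-- Any set of increasing pairs in which no two share a left end or a right end is the bump set of
a set partition: its parts are the connected components. -/
theorem exists_bumps_eq (R : Set (Fin n × Fin n)) (hlt : ∀ a b, (a, b) ∈ R → a < b)
    (hr : ∀ a b b', (a, b) ∈ R → (a, b') ∈ R → b = b')
    (hl : ∀ a a' b, (a, b) ∈ R → (a', b) ∈ R → a = a') :
    ∃ P : Finpartition (univ : Finset (Fin n)), bumps P = R := by
  let r : Fin n → Fin n → Prop := fun a b => (a, b) ∈ R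
  let s : Setoid (Fin n) := EqvGen.setoid r
  have hle : ∀ a b, ReflTransGen r a b → a ≤ b := by
    intro a b h
    induction h with
    | refl => exact le_rfl
    | tail _ hbc ih => exact ih.trans (hlt _ _ hbc).le
  have hto : ∀ a b, ReflTransGen r a b → EqvGen r a b := by
    intro a b h
    induction h with
    | refl => exact EqvGen.refl _
    | tail _ hbc ih => exact ih.trans _ _ _ (EqvGen.rel _ _ hbc)
  have hgen : ∀ a b, EqvGen r a b → ReflTransGen r a b ∨ ReflTransGen r b a := by
    intro a b h
    induction h with
    | rel a b h => exact Or.inl (ReflTransGen.single h)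
    | refl a => exact Or.inl ReflTransGen.refl
    | symm a b _ ih => exact ih.symm
    | trans a b c _ _ ih1 ih2 =>
      rcases ih1 with h1 | h1 <;> rcases ih2 with h2 | h2
      · exact Or.inl (h1.trans h2)
      · -- both `a` and `c` reach `b`
        have hu : Relator.RightUnique (Function.swap r) := fun x y z hy hz => hl _ _ _ hy hz
        rcases ReflTransGen.total_of_right_unique hu (reflTransGen_swap.2 h1)
          (reflTransGen_swap.2 h2) with h | h
        · exact Or.inr (reflTransGen_swap.1 h)
        · exact Or.inl (reflTransGen_swap.1 h)
      · have hu : Relator.RightUnique r := fun x y z hy hz => hr _ _ _ hy hz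
        exact ReflTransGen.total_of_right_unique hu h1 h2
      · exact Or.inr (h2.trans h1)
  have hpart : ∀ a b, (Finpartition.ofSetoid s).part a = (Finpartition.ofSetoid s).part b ↔
      EqvGen r a b := by
    intro a b
    rw [eq_comm, ← mem_part_iff, Finpartition.mem_part_ofSetoid_iff_rel]
    rfl
  refine ⟨Finpartition.ofSetoid s, ?_⟩
  ext ⟨a, b⟩
  rw [mem_bumps_iff]
  simp only [hpart]
  constructor
  · rintro ⟨hab, he, hc⟩
    rcases hgen a b he with h | h
    · rcases ReflTransGen.cases_head h with rfl | ⟨c, hac, hcb⟩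
      · exact absurd hab (lt_irrefl _)
      · rcases eq_or_lt_of_le (hle c b hcb) with rfl | hlt'
        · exact hac
        · exact absurd ⟨hlt _ _ hac, hlt'⟩
            (hc c ((EqvGen.rel _ _ hac).symm))
    · exact absurd (hle _ _ h) (not_le.2 hab)
  · intro h
    refine ⟨hlt _ _ h, EqvGen.rel _ _ h, ?_⟩
    rintro c hc ⟨hac, hcb⟩
    rcases hgen c a hc with h' | h'
    · exact absurd (hle _ _ h') (not_le.2 hac)
    · rcases ReflTransGen.cases_head h' with rfl | ⟨d, had, hdc⟩
      · exact lt_irrefl _ hac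
      · obtain rfl := hr _ _ _ h had
        exact absurd (hle _ _ hdc) (not_le.2 hcb)

variable {J : Set (Equiv.Perm (Fin n))}

theorem transversal_iff :
    Transversal J P ↔ ∀ a b, (a, b) ∈ bumps P → ¬ SameRegion J a b := by
  constructor
  · intro h a b hab hs
    exact h a b (bumps_lt hab).ne hs (P.part a) (P.part_mem.2 (mem_univ _))
      ⟨mem_part_iff.2 rfl, mem_part_iff.2 (bumps_part hab).symm⟩
  · intro h i j hij hs B hB hm
    have he : P.part i = P.part j :=
      (P.part_eq_of_mem hB hm.1).trans (P.part_eq_of_mem hB hm.2).symm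
    rcases lt_or_gt_of_ne hij with hlt | hlt
    · obtain ⟨c, hc, hb⟩ := exists_bump_right hlt he
      exact h _ _ hb (hs.between (bumps_lt hb).le hc)
    · obtain ⟨c, hc, hb⟩ := exists_bump_right hlt he.symm
      exact h _ _ hb (hs.symm.between (bumps_lt hb).le hc)

end

/-! ### From avoiding permutations to noncrossing partitions -/

section
variable {n : ℕ} {J : Set (Equiv.Perm (Fin n))} {w : Equiv.Perm (Fin n)}
  {P : Finpartition (univ : Finset (Fin n))}

theorem mem_des_iff {a b : Fin n} : (a, b) ∈ des w ↔ a < b ∧ (w a).val = (w b).val + 1 :=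
  ⟨fun h => ⟨h.1, h.2.2⟩, fun h => ⟨h.1, Fin.lt_def.2 (by simp only [h.2]; omega), h.2⟩⟩

theorem strictMono_of_mem_avoiding231 (hw : w ∈ avoiding231 J) {x y : Fin n} (h : x < y)
    (hs : SameRegion J x y) : w x < w y :=
  mem_parabolicQuotient_iff.1 hw.1 x y h hs

/-- Under a descent `(i, k)` of an avoiding permutation, the values in other regions than that of
`i` are small: this combines avoidance with the increase inside the region of `k`. -/
theorem lt_of_mem_des (hw : w ∈ avoiding231 J) {i m k : Fin n} (h : (i, k) ∈ des w)
    (him : i < m) (hmk : m < k) (hs : ¬ SameRegion J i m) : w m < w i := by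
  by_cases hmk' : SameRegion J m k
  · exact (strictMono_of_mem_avoiding231 hw hmk hmk').trans h.2.1
  · by_contra hlt
    have hlt' : w i < w m := lt_of_le_of_ne (not_lt.1 hlt) fun h => him.ne (w.injective h)
    exact hw.2 ⟨i, m, k, him, hmk, hs, hmk', fun h' => hs (h'.between him.le hmk.le), h.2.1, hlt',
      h.2.2⟩

theorem exists_noncrossing_of_mem_avoiding231 (hw : w ∈ avoiding231 J) :
    ∃ P ∈ noncrossing J, bumps P = des w := by
  obtain ⟨P, hP⟩ := exists_bumps_eq (des w) (fun a b h => h.1)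
    (fun a b b' h h' => w.injective (Fin.ext (by
      have h1 := (mem_des_iff.1 h).2
      have h2 := (mem_des_iff.1 h').2
      omega)))
    (fun a a' b h h' => w.injective (Fin.ext (by
      have h1 := (mem_des_iff.1 h).2
      have h2 := (mem_des_iff.1 h').2
      omega)))
  have hcross : ∀ a b, (a, b) ∈ des w → ¬ SameRegion J a b := fun a b h hs =>
    absurd (strictMono_of_mem_avoiding231 hw h.1 hs) (not_lt.2 h.2.1.le)
  refine ⟨P, ⟨transversal_iff.2 (hP ▸ hcross), ?_, ?_⟩, hP⟩
  · rw [hP]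
    intro i₁ i₂ j₁ j₂ hi hj h1 h2 h3
    by_contra hne
    push Not at hne
    have hlt1 := Fin.lt_def.1 (lt_of_mem_des hw hi h1 h2 hne.1)
    have hlt2 := Fin.lt_def.1 (lt_of_mem_des hw hj h2 h3 fun h => hne.2 h.symm)
    have := (mem_des_iff.1 hi).2
    omega
  · rw [hP]
    intro i₁ i₂ j₁ j₂ hi hj h1 h2 h3 hs
    have hlt1 := Fin.lt_def.1 (strictMono_of_mem_avoiding231 hw h1 hs)
    have hlt2 := Fin.lt_def.1 (lt_of_mem_des hw hi (h1.trans h2) h3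
      fun h => hcross _ _ hj (hs.symm.trans h))
    have := (mem_des_iff.1 hj).2
    omega

/-- If the bumps of `P` are the descents of `w`, then `w` maps each part decreasingly onto an
interval. -/
theorem part_values (h : bumps P = des w) {x y : Fin n} (hxy : x ≤ y)
    (he : P.part x = P.part y) :
    w y ≤ w x ∧ ∀ z, w y ≤ w z → w z ≤ w x → P.part z = P.part x := by
  induction y using WellFoundedLT.induction with
  | _ y ih =>
  rcases eq_or_lt_of_le hxy with rfl | hlt
  · exact ⟨le_rfl, fun z h1 h2 => by rw [w.injective (le_antisymm h2 h1)]⟩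
  · obtain ⟨c, hc, hb⟩ := exists_bump_left hlt he
    have hd := hb
    rw [h, mem_des_iff] at hd
    obtain ⟨h1, h2⟩ := ih c hd.1 hc (he.trans (bumps_part hb).symm)
    have h3 := Fin.le_def.1 h1
    refine ⟨Fin.le_def.2 (by omega), fun z hz1 hz2 => ?_⟩
    rcases eq_or_lt_of_le hz1 with heq | hzlt
    · rw [← w.injective heq, he]
    · have := Fin.lt_def.1 hzlt
      exact h2 z (Fin.le_def.2 (by omega)) hz2

theorem part_eq_of_between (h : bumps P = des w) {x y z : Fin n} (he : P.part x = P.part y)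
    (h1 : w y ≤ w z) (h2 : w z ≤ w x) : P.part z = P.part x := by
  rcases le_total x y with hxy | hxy
  · exact (part_values h hxy he).2 z h1 h2
  · have h3 := (part_values h hxy he.symm).1
    have h4 : w z = w x := le_antisymm h2 (h3.trans h1)
    rw [w.injective h4]

theorem lt_of_part_eq (h : bumps P = des w) {x y x' y' : Fin n} (hne : P.part x ≠ P.part y)
    (hlt : w x < w y) (hx : P.part x' = P.part x) (hy : P.part y' = P.part y) : w x' < w y' := by
  by_contra hcon
  have hcon := not_lt.1 hcon
  rcases lt_or_ge (w x') (w y) with h1 | h1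
  · exact hne (hx.symm.trans (part_eq_of_between h hy.symm hcon h1.le))
  · exact hne ((part_eq_of_between h hx hlt.le h1).trans hx).symm

theorem lt_of_partRel (hw : w ∈ avoiding231 J) (h : bumps P = des w) {x y : Fin n}
    (hr : PartRel J P (P.part x) (P.part y)) : w y < w x := by
  obtain ⟨-, -, i₁, i₂, m, hb, hi, -, hm, h1, h2, hs⟩ := hr
  have hi' := mem_part_iff.1 hi
  have hm' := mem_part_iff.1 (mem_coe.1 hm.1)
  have hlt := lt_of_mem_des hw (h ▸ hb) h1 h2 hs
  exact lt_of_part_eq h (bumps_part_ne hb h1 h2) hlt hm'.symm hi'.symm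

theorem lt_of_reflTransGen_partRel (hw : w ∈ avoiding231 J) (h : bumps P = des w) {x y : Fin n}
    (hr : ReflTransGen (PartRel J P) (P.part x) (P.part y)) (hne : P.part x ≠ P.part y) :
    w y < w x := by
  have key : ∀ B, ReflTransGen (PartRel J P) (P.part x) B → B = P.part x ∨
      ∀ y ∈ B, w y < w x := by
    intro B hB
    induction hB with
    | refl => exact Or.inl rfl
    | tail h1 h2 ih =>
      rename_i B C
      right
      intro y hy
      have hC := P.part_eq_of_mem h2.2.1 hy
      have hBx : ∃ b, b ∈ B := P.nonempty_of_mem_parts h2.1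
      obtain ⟨b, hb⟩ := hBx
      have hB' := P.part_eq_of_mem h2.1 hb
      rw [← hC, ← hB'] at h2
      rcases ih with rfl | ih
      · rw [hB'] at h2
        exact lt_of_partRel hw h h2
      · exact (lt_of_partRel hw h h2).trans (ih b hb)
  rcases key _ hr with h1 | h1
  · exact absurd h1.symm hne
  · exact h1 y (mem_part_iff.2 rfl)

/-- Let `A` be a union of parts on which `w` takes an interval of values, with minimum `a`. Then
each part in `A` with smaller values than `a` lies above the part of `a`. -/
theorem reflTransGen_partRel_of_le (hw : w ∈ avoiding231 J) (h : bumps P = des w)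
    {A : Finset (Fin n)} {c d : ℕ} (hA : ∀ x, x ∈ A ↔ c ≤ (w x).val ∧ (w x).val < d)
    (hsat : ∀ x ∈ A, ∀ y, P.part y = P.part x → y ∈ A) {a : Fin n} (ha : a ∈ A)
    (hmin : ∀ x ∈ A, a ≤ x) :
    ∀ k : ℕ, ∀ x ∈ A, (w a).val = (w x).val + k →
      ReflTransGen (PartRel J P) (P.part a) (P.part x) := by
  intro k
  induction k using Nat.strong_induction_on with
  | _ k ih =>
  intro x hx hk
  by_cases he : P.part x = P.part a
  · rw [he]
  have hne : (P.part x).Nonempty := ⟨x, mem_part_iff.2 rfl⟩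
  obtain ⟨m, hm⟩ : ∃ m, m = (P.part x).min' hne := ⟨_, rfl⟩
  have hleast : IsLeast (P.part x : Set (Fin n)) m := hm ▸ (P.part x).isLeast_min' hne
  have hmx : P.part m = P.part x := mem_part_iff.1 (mem_coe.1 hleast.1)
  have hmA : m ∈ A := hsat x hx m hmx
  have ham : a < m := lt_of_le_of_ne (hmin m hmA) fun h => he (by rw [h, hmx])
  have hwa : w m < w a := lt_of_part_eq h he (Fin.lt_def.2 (by
    have : w x ≠ w a := fun h => he (by rw [w.injective h])
    have : (w x).val ≠ (w a).val := fun h => this (Fin.ext h)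
    omega)) hmx rfl
  have hxm : w x ≤ w m :=
    (part_values h (hleast.2 (mem_coe.2 (mem_part_iff.2 rfl))) hmx).1
  -- the smallest value above `w m` that sits to the left of `m` starts a bump over `m`
  have hex : ∃ v : ℕ, ∃ hv : v < n, (w m).val < v ∧ w.symm ⟨v, hv⟩ < m :=
    ⟨(w a).val, (w a).2, hwa, by simpa using ham⟩
  classical
  obtain ⟨hv, hmv, hvm⟩ := Nat.find_spec hex
  have hva : Nat.find hex ≤ (w a).val := Nat.find_min' hex ⟨(w a).2, hwa, by simpa using ham⟩
  have hprev := fun u (hu : u < Nat.find hex) => Nat.find_min hex hu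
  generalize Nat.find hex = v at *
  obtain ⟨i, hi⟩ : ∃ i, i = w.symm ⟨v, hv⟩ := ⟨_, rfl⟩
  obtain ⟨j, hj⟩ : ∃ j, j = w.symm ⟨v - 1, by omega⟩ := ⟨_, rfl⟩
  have hwi : (w i).val = v := by simp [hi]
  have hwj : (w j).val = v - 1 := by simp [hj]
  rw [← hi] at hvm
  have hmj : m ≤ j := by
    by_contra hcon
    rcases eq_or_lt_of_le (show (w m).val ≤ v - 1 by omega) with h1 | h1
    · exact hcon (le_of_eq (w.injective (Fin.ext (h1.trans hwj.symm))))
    · exact hprev (v - 1) (by omega) ⟨by omega, h1, hj ▸ not_le.1 hcon⟩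
  have hb : (i, j) ∈ bumps P := by
    rw [h, mem_des_iff]
    exact ⟨hvm.trans_le hmj, by omega⟩
  have hmj' : m < j := lt_of_le_of_ne hmj fun hmj => by
    subst hmj
    exact absurd (hleast.2 (mem_coe.2 (mem_part_iff.2 ((bumps_part hb).trans hmx))))
      (not_le.2 hvm)
  have hs : ¬ SameRegion J i m := fun hs => by
    have := Fin.lt_def.1 (strictMono_of_mem_avoiding231 hw hvm hs)
    omega
  have hiA : i ∈ A := by
    rw [hA]
    have h1 := (hA m).1 hmA
    have h2 := (hA a).1 ha
    omega
  have hxm' := Fin.le_def.1 hxm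
  refine (ih ((w a).val - v) (by omega) i hiA (by omega)).tail ?_
  exact ⟨P.part_mem.2 (mem_univ _), P.part_mem.2 (mem_univ _), i, j, m, hb,
    mem_part_iff.2 rfl, mem_part_iff.2 (bumps_part hb).symm, hleast, hvm, hmj', hs⟩

theorem mem_partFilter_iff {A : Finset (Fin n)} {a x : Fin n} : x ∈ partFilter J P A a ↔
    x ∈ A ∧ ReflTransGen (PartRel J P) (P.part a) (P.part x) := by
  simp [partFilter]

theorem recursiveWord_of_mem_part {A : Finset (Fin n)} (hA : A.Nonempty) {j : Fin n}
    (hj : P.part j = P.part (A.min' hA)) :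
    recursiveWord J P A j = #(partFilter J P A (A.min' hA)) -
      #{c ∈ P.part (A.min' hA) | c < j} := by
  rw [recursiveWord, dif_pos hA, if_pos (mem_part_iff.2 hj)]

theorem recursiveWord_of_mem_partFilter {A : Finset (Fin n)} (hA : A.Nonempty) {j : Fin n}
    (hj : P.part j ≠ P.part (A.min' hA)) (hjX : j ∈ partFilter J P A (A.min' hA)) :
    recursiveWord J P A j =
      recursiveWord J P (partFilter J P A (A.min' hA) \ P.part (A.min' hA)) j := by
  rw [recursiveWord, dif_pos hA, if_neg (mt mem_part_iff.1 hj), if_pos hjX]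

theorem recursiveWord_of_notMem_partFilter {A : Finset (Fin n)} (hA : A.Nonempty) {j : Fin n}
    (hj : P.part j ≠ P.part (A.min' hA)) (hjX : j ∉ partFilter J P A (A.min' hA)) :
    recursiveWord J P A j = #(partFilter J P A (A.min' hA)) +
      recursiveWord J P (A \ partFilter J P A (A.min' hA)) j := by
  rw [recursiveWord, dif_pos hA, if_neg (mt mem_part_iff.1 hj), if_neg hjX]

theorem min'_mem_partFilter {A : Finset (Fin n)} (hA : A.Nonempty) :
    A.min' hA ∈ partFilter J P A (A.min' hA) :=
  mem_partFilter_iff.2 ⟨A.min'_mem hA, .refl⟩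

theorem partFilter_sdiff_part_ssubset {A : Finset (Fin n)} (hA : A.Nonempty) :
    partFilter J P A (A.min' hA) \ P.part (A.min' hA) ⊂ A := by
  refine (ssubset_iff_of_subset fun x hx => ?_).2 ⟨A.min' hA, A.min'_mem hA, fun h => ?_⟩
  · exact (mem_partFilter_iff.1 (mem_sdiff.1 hx).1).1
  · exact (mem_sdiff.1 h).2 (mem_part_iff.2 rfl)

theorem sdiff_partFilter_ssubset {A : Finset (Fin n)} (hA : A.Nonempty) :
    A \ partFilter J P A (A.min' hA) ⊂ A :=
  (ssubset_iff_of_subset sdiff_subset).2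
    ⟨A.min' hA, A.min'_mem hA, fun h => (mem_sdiff.1 h).2 (min'_mem_partFilter hA)⟩

theorem card_eq_of_values {A : Finset (Fin n)} {c d : ℕ} (hd : d ≤ n)
    (hA : ∀ x, x ∈ A ↔ c ≤ (w x).val ∧ (w x).val < d) : #A = d - c := by
  rw [← Nat.card_Ico]
  refine card_bij (fun x _ => (w x).val) (fun x hx => by simpa using (hA x).1 hx)
    (fun x _ y _ h => w.injective (Fin.ext h)) fun v hv => ?_
  have hv := mem_Ico.1 hv
  exact ⟨w.symm ⟨v, by omega⟩, by simpa [hA] using hv, by simp⟩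

/-- An avoiding permutation is recovered from its descent partition by the recursive word. -/
theorem recursiveWord_eq_of_avoiding (hw : w ∈ avoiding231 J) (h : bumps P = des w)
    (A : Finset (Fin n)) : ∀ c d : ℕ, d ≤ n →
    (∀ x, x ∈ A ↔ c ≤ (w x).val ∧ (w x).val < d) →
    (∀ x ∈ A, ∀ y, P.part y = P.part x → y ∈ A) →
    ∀ j ∈ A, recursiveWord J P A j + c = (w j).val + 1 := by
  induction A using Finset.strongInduction with
  | _ A ih =>
  intro c d hd hval hsat j hj
  have hA : A.Nonempty := ⟨j, hj⟩
  have haA := A.min'_mem hA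
  have hmin : ∀ x ∈ A, A.min' hA ≤ x := fun x hx => A.min'_le x hx
  have hss1 := partFilter_sdiff_part_ssubset (J := J) (P := P) hA
  have hss2 := sdiff_partFilter_ssubset (J := J) (P := P) hA
  have hpart := recursiveWord_of_mem_part (J := J) (P := P) hA (j := j)
  have hin := recursiveWord_of_mem_partFilter (J := J) (P := P) hA (j := j)
  have hout := recursiveWord_of_notMem_partFilter (J := J) (P := P) hA (j := j)
  generalize A.min' hA = a at *
  have hac := (hval a).1 haA
  have hX : ∀ x, x ∈ partFilter J P A a ↔ c ≤ (w x).val ∧ (w x).val < (w a).val + 1 := by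
    intro x
    rw [mem_partFilter_iff]
    constructor
    · rintro ⟨hxA, hr⟩
      refine ⟨((hval x).1 hxA).1, ?_⟩
      by_cases he : P.part a = P.part x
      · have := Fin.le_def.1 (part_values h (hmin x hxA) he).1
        omega
      · have := Fin.lt_def.1 (lt_of_reflTransGen_partRel hw h hr he)
        omega
    · rintro ⟨h1, h2⟩
      have hxA : x ∈ A := (hval x).2 ⟨h1, by omega⟩
      exact ⟨hxA, reflTransGen_partRel_of_le hw h hval hsat haA hmin ((w a).val - (w x).val) x hxA
        (by omega)⟩
  have hXcard := card_eq_of_values (by have := (w a).2; omega) hX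
  by_cases hja : P.part j = P.part a
  · rw [hpart hja]
    have hcard : #{x ∈ P.part a | x < j} = (w a).val + 1 - ((w j).val + 1) := by
      refine card_eq_of_values (w := w) (by have := (w a).2; omega) fun x => ?_
      rw [mem_filter, mem_part_iff]
      constructor
      · rintro ⟨hx, hxj⟩
        have h1 := (part_values h (hmin x (hsat a haA x hx)) hx.symm).1
        have h2 := (part_values h hxj.le (hx.trans hja.symm)).1
        have h3 : w j ≠ w x := fun h => hxj.ne' (w.injective h)
        have h4 := Fin.lt_def.1 (lt_of_le_of_ne h2 h3)
        have h5 := Fin.le_def.1 h1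
        omega
      · rintro ⟨h1, h2⟩
        have hx : P.part x = P.part a := part_eq_of_between h hja.symm
          (Fin.le_def.2 (by omega)) (Fin.le_def.2 (by omega))
        refine ⟨hx, lt_of_not_ge fun hjx => ?_⟩
        have := Fin.le_def.1 (part_values h hjx (hja.trans hx.symm)).1
        omega
    have h1 := Fin.le_def.1 (part_values h (hmin j hj) hja.symm).1
    have h2 := (hval j).1 hj
    rw [hXcard, hcard]
    omega
  by_cases hjX : j ∈ partFilter J P A a
  · rw [hin hja hjX]
    have hne : (P.part a).Nonempty := ⟨a, mem_part_iff.2 rfl⟩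
    obtain ⟨z, hz, hzmax⟩ := (P.part a).exists_max_image id hne
    rw [mem_part_iff] at hz
    have hza := Fin.le_def.1 (part_values h (hmin z (hsat a haA z hz)) hz.symm).1
    refine ih _ hss1 c (w z).val (w z).2.le (fun x => ?_) (fun x hx y hy => ?_) j
      (mem_sdiff.2 ⟨hjX, mt mem_part_iff.1 hja⟩)
    · rw [mem_sdiff, hX, mem_part_iff]
      constructor
      · rintro ⟨h1, h2⟩
        refine ⟨h1.1, lt_of_not_ge fun h3 => h2 ?_⟩
        exact part_eq_of_between h hz.symm (Fin.le_def.2 h3) (Fin.le_def.2 (by omega))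
      · rintro ⟨h1, h2⟩
        refine ⟨⟨h1, by omega⟩, fun hx => ?_⟩
        have := Fin.le_def.1 (part_values h (hzmax x (mem_part_iff.2 hx)) (hx.trans hz.symm)).1
        simp only [id] at this
        omega
    · rw [mem_sdiff, mem_partFilter_iff, mem_part_iff] at hx ⊢
      rw [hy]
      exact ⟨⟨hsat x hx.1.1 y hy, hx.1.2⟩, hx.2⟩
  · rw [hout hja hjX, hXcard]
    have := ih _ hss2 ((w a).val + 1) d hd (fun x => ?_) (fun x hx y hy => ?_) j
      (mem_sdiff.2 ⟨hj, hjX⟩)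
    · omega
    · rw [mem_sdiff, hX, hval]
      omega
    · rw [mem_sdiff, mem_partFilter_iff] at hx ⊢
      rw [hy]
      exact ⟨hsat x hx.1 y hy, fun h => hx.2 ⟨hx.1, h.2⟩⟩

end

/-! ### The relation on the parts of a noncrossing partition -/

section
variable {n : ℕ} {J : Set (Equiv.Perm (Fin n))} {P : Finpartition (univ : Finset (Fin n))}

theorem PartRel.exists_lt {B B' : Finset (Fin n)} (h : PartRel J P B B') :
    ∃ x ∈ B, ∀ y ∈ B', x < y := by
  obtain ⟨-, -, i₁, i₂, m, hb, hi, -, hm, h1, h2, hs⟩ := h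
  exact ⟨i₁, hi, fun y hy => h1.trans_le (hm.2 (mem_coe.2 hy))⟩

theorem exists_lt_of_reflTransGen {B B' : Finset (Fin n)}
    (h : ReflTransGen (PartRel J P) B B') (hne : B ≠ B') : ∃ x ∈ B, ∀ y ∈ B', x < y := by
  induction h with
  | refl => exact absurd rfl hne
  | tail h1 h2 ih =>
    rename_i C D
    by_cases hC : B = C
    · exact hC ▸ h2.exists_lt
    · obtain ⟨x, hx, hxC⟩ := ih hC
      obtain ⟨y, hy, hyD⟩ := h2.exists_lt
      exact ⟨x, hx, fun z hz => (hxC y hy).trans (hyD z hz)⟩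

theorem reflTransGen_partRel_antisymm {B B' : Finset (Fin n)}
    (h : ReflTransGen (PartRel J P) B B') (h' : ReflTransGen (PartRel J P) B' B) : B = B' := by
  by_contra hne
  obtain ⟨x, hx, hxB⟩ := exists_lt_of_reflTransGen h hne
  obtain ⟨y, hy, hyB⟩ := exists_lt_of_reflTransGen h' (Ne.symm hne)
  exact lt_asymm (hxB y hy) (hyB x hx)

theorem PartRel.ne {B B' : Finset (Fin n)} (h : PartRel J P B B') : B ≠ B' := by
  rintro rfl
  obtain ⟨x, hx, hxB⟩ := h.exists_lt
  exact lt_irrefl x (hxB x hx)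

theorem partRel_of_bump {i j m : Fin n} (hb : (i, j) ∈ bumps P) (him : i < m) (hmj : m < j)
    (hs : ¬ SameRegion J i m) (hm : ∀ c, P.part c = P.part m → m ≤ c) :
    PartRel J P (P.part i) (P.part m) :=
  ⟨P.part_mem.2 (mem_univ _), P.part_mem.2 (mem_univ _), i, j, m, hb, mem_part_iff.2 rfl,
    mem_part_iff.2 (bumps_part hb).symm,
    ⟨mem_coe.2 (mem_part_iff.2 rfl), fun c hc => hm c (mem_part_iff.1 (mem_coe.1 hc))⟩,
    him, hmj, hs⟩

/-- A part with an element `m` under a bump `(p, q)` lies above the part of `p`, or it reaches to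
the left of `p` inside the region of `p`. -/
theorem partRel_or_exists (hP : P ∈ noncrossing J) {p q m : Fin n} (hb : (p, q) ∈ bumps P)
    (hpm : p < m) (hmq : m < q) (hs : ¬ SameRegion J p m) :
    PartRel J P (P.part p) (P.part m) ∨
      ∃ e, P.part e = P.part m ∧ SameRegion J e p ∧ e < p := by
  induction m using WellFoundedLT.induction with
  | _ m ih =>
  by_cases hm : ∀ c, P.part c = P.part m → m ≤ c
  · exact Or.inl (partRel_of_bump hb hpm hmq hs hm)
  · push Not at hm
    obtain ⟨c, hc, hcm⟩ := hm
    obtain ⟨e, -, he⟩ := exists_bump_left hcm hc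
    rcases lt_trichotomy e p with hlt | rfl | hlt
    · rcases hP.2.1 e m p q he hb hlt hpm hmq with h | h
      · exact Or.inr ⟨e, bumps_part he, h, hlt⟩
      · exact absurd h.symm hs
    · exact absurd (bumps_part he).symm (bumps_part_ne hb hpm hmq)
    · rw [← bumps_part he]
      exact ih e (bumps_lt he) hlt ((bumps_lt he).trans hmq) (hP.2.2 p q e m hb he hlt
        (bumps_lt he) hmq)

/-- The order on parts is compatible with the order inside a region: if the part of `y` is above
that of `a`, then so is the part of any `x < y` in the region of `y`, strictly so, unless it starts
to the left of the part of `a`. -/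
theorem reflTransGen_of_sameRegion (hP : P ∈ noncrossing J) {a x y : Fin n}
    (hr : ReflTransGen (PartRel J P) (P.part a) (P.part y)) (hxy : x < y)
    (hs : SameRegion J x y) :
    (ReflTransGen (PartRel J P) (P.part a) (P.part x) ∧ P.part x ≠ P.part a) ∨
      ∃ x', P.part x' = P.part x ∧ ∀ z, P.part z = P.part a → x' < z := by
  induction y using WellFoundedLT.induction generalizing x with
  | _ y ih =>
  -- a bump `(p, q)` over `x` that starts to the left of the region of `x`
  have key : ∀ p q, (p, q) ∈ bumps P → ReflTransGen (PartRel J P) (P.part a) (P.part p) →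
      p < x → x < q → p < y → ¬ SameRegion J p x →
      (ReflTransGen (PartRel J P) (P.part a) (P.part x) ∧ P.part x ≠ P.part a) ∨
      ∃ x', P.part x' = P.part x ∧ ∀ z, P.part z = P.part a → x' < z := by
    intro p q hb hrp hpx hxq hpy hpxs
    rcases partRel_or_exists hP hb hpx hxq hpxs with h | ⟨e, he, hes, hep⟩
    · refine Or.inl ⟨hrp.tail h, fun heq => ?_⟩
      rw [heq] at h
      exact h.ne (reflTransGen_partRel_antisymm hrp (.single h)).symm
    · rw [← he]
      exact ih p hpy hrp hep hes
  by_cases hy : ∀ c, P.part c = P.part y → y ≤ c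
  · rcases ReflTransGen.cases_tail hr with heq | ⟨D, hD, i₁, i₂, hb⟩
    · exact Or.inr ⟨x, rfl, fun z hz => hxy.trans_le (hy z (hz.trans heq.symm))⟩
    · obtain ⟨p, q, m, hb, hp, -, hm, h1, h2, h3⟩ := hb
      have hmy : m = y := le_antisymm (hm.2 (mem_coe.2 (mem_part_iff.2 rfl)))
        (hy m (mem_part_iff.1 (mem_coe.1 hm.1)))
      subst hmy
      have hpx : p < x := lt_of_not_ge fun hxp =>
        h3 (hs.between_right hxp h1.le)
      rw [← P.part_eq_of_mem i₁ hp] at hD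
      exact key p q hb hD hpx (hxy.trans h2) h1 fun h => h3 (h.trans hs)
  · push Not at hy
    obtain ⟨c, hc, hcy⟩ := hy
    obtain ⟨p, -, hb⟩ := exists_bump_left hcy hc
    have hpys := transversal_iff.1 hP.1 _ _ hb
    have hpx : p < x := lt_of_not_ge fun hxp => hpys (hs.between_right hxp (bumps_lt hb).le)
    rw [← bumps_part hb] at hr
    exact key p y hb hr hpx hxy (bumps_lt hb) fun h => hpys (h.trans hs)

end

/-! ### The recursive word of a noncrossing partition -/

section
variable {n : ℕ} {J : Set (Equiv.Perm (Fin n))} {P : Finpartition (univ : Finset (Fin n))}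

/-- `A` is a union of parts of `P`. -/
def Saturated (P : Finpartition (univ : Finset (Fin n))) (A : Finset (Fin n)) : Prop :=
  ∀ x ∈ A, ∀ y, P.part y = P.part x → y ∈ A

theorem Saturated.partFilter_sdiff {A : Finset (Fin n)} (h : Saturated P A) (a : Fin n) :
    Saturated P (partFilter J P A a \ P.part a) := by
  intro x hx y hy
  rw [mem_sdiff, mem_partFilter_iff, mem_part_iff] at hx ⊢
  rw [hy]
  exact ⟨⟨h x hx.1.1 y hy, hx.1.2⟩, hx.2⟩

theorem Saturated.sdiff_partFilter {A : Finset (Fin n)} (h : Saturated P A) (a : Fin n) :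
    Saturated P (A \ partFilter J P A a) := by
  intro x hx y hy
  rw [mem_sdiff, mem_partFilter_iff] at hx ⊢
  rw [hy]
  exact ⟨h x hx.1 y hy, fun h => hx.2 ⟨hx.1, h.2⟩⟩

theorem Saturated.part_subset_partFilter {A : Finset (Fin n)} (h : Saturated P A) {a : Fin n}
    (ha : a ∈ A) : P.part a ⊆ partFilter J P A a := fun x hx => by
  rw [mem_part_iff] at hx
  rw [mem_partFilter_iff, hx]
  exact ⟨h a ha x hx, .refl⟩

/-- The values of the recursive word on the part of the minimum are the largest ones of its
order filter. -/
theorem recursiveWord_bounds_of_mem_part {A : Finset (Fin n)} (hsat : Saturated P A)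
    (hA : A.Nonempty) {j : Fin n} (hj : P.part j = P.part (A.min' hA)) :
    #(partFilter J P A (A.min' hA) \ P.part (A.min' hA)) < recursiveWord J P A j ∧
      recursiveWord J P A j ≤ #(partFilter J P A (A.min' hA)) := by
  rw [recursiveWord_of_mem_part hA hj]
  have hsub := hsat.part_subset_partFilter (J := J) (A.min'_mem hA)
  have h1 := card_sdiff_add_card_eq_card hsub
  have h2 : #{c ∈ P.part (A.min' hA) | c < j} < #(P.part (A.min' hA)) :=
    card_lt_card ((ssubset_iff_of_subset (filter_subset _ _)).2
      ⟨j, mem_part_iff.2 hj, by simp⟩)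
  omega

theorem recursiveWord_lt_of_mem_part {A : Finset (Fin n)} (hsat : Saturated P A)
    (hA : A.Nonempty) {i j : Fin n} (hi : P.part i = P.part (A.min' hA))
    (hj : P.part j = P.part (A.min' hA)) (hij : i < j) :
    recursiveWord J P A j < recursiveWord J P A i := by
  have h1 := recursiveWord_bounds_of_mem_part (J := J) hsat hA hj
  rw [recursiveWord_of_mem_part hA hj] at h1 ⊢
  rw [recursiveWord_of_mem_part hA hi]
  have h2 : #{c ∈ P.part (A.min' hA) | c < i} < #{c ∈ P.part (A.min' hA) | c < j} := by
    refine card_lt_card ((ssubset_iff_of_subset fun c hc => ?_).2 ⟨i, ?_, by simp⟩)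
    · rw [mem_filter] at hc ⊢
      exact ⟨hc.1, hc.2.trans hij⟩
    · rw [mem_filter]
      exact ⟨mem_part_iff.2 hi, hij⟩
  omega

theorem recursiveWord_mem_Icc {A : Finset (Fin n)} (hsat : Saturated P A) :
    ∀ j ∈ A, 1 ≤ recursiveWord J P A j ∧ recursiveWord J P A j ≤ #A := by
  induction A using Finset.strongInduction with
  | _ A ih =>
  intro j hj
  have hA : A.Nonempty := ⟨j, hj⟩
  have hle : #(partFilter J P A (A.min' hA)) ≤ #A := card_le_card (filter_subset _ _)
  by_cases hja : P.part j = P.part (A.min' hA)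
  · have := recursiveWord_bounds_of_mem_part (J := J) hsat hA hja
    omega
  by_cases hjX : j ∈ partFilter J P A (A.min' hA)
  · rw [recursiveWord_of_mem_partFilter hA hja hjX]
    have h1 := ih _ (partFilter_sdiff_part_ssubset (J := J) hA) (hsat.partFilter_sdiff _) j
      (mem_sdiff.2 ⟨hjX, mt mem_part_iff.1 hja⟩)
    have h2 : #(partFilter J P A (A.min' hA) \ P.part (A.min' hA)) ≤
      #(partFilter J P A (A.min' hA)) := card_le_card sdiff_subset
    omega
  · rw [recursiveWord_of_notMem_partFilter hA hja hjX]
    have h1 := ih _ (sdiff_partFilter_ssubset (J := J) hA) (hsat.sdiff_partFilter _) j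
      (mem_sdiff.2 ⟨hj, hjX⟩)
    have h2 : #(A \ partFilter J P A (A.min' hA)) + #(partFilter J P A (A.min' hA)) = #A :=
      card_sdiff_add_card_eq_card (filter_subset _ _)
    omega

/-- The three zones of the recursive word: the part of the minimum takes top values of the order
filter, the remaining elements of the order filter take smaller values, and the elements outside
take larger values. -/
theorem recursiveWord_cases {A : Finset (Fin n)} (hsat : Saturated P A) (hA : A.Nonempty)
    {j : Fin n} (hj : j ∈ A) :
    (P.part j = P.part (A.min' hA) ∧
      #(partFilter J P A (A.min' hA) \ P.part (A.min' hA)) < recursiveWord J P A j ∧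
      recursiveWord J P A j ≤ #(partFilter J P A (A.min' hA))) ∨
    (P.part j ≠ P.part (A.min' hA) ∧
      ReflTransGen (PartRel J P) (P.part (A.min' hA)) (P.part j) ∧
      j ∈ partFilter J P A (A.min' hA) \ P.part (A.min' hA) ∧
      recursiveWord J P A j ≤ #(partFilter J P A (A.min' hA) \ P.part (A.min' hA)) ∧
      recursiveWord J P A j =
        recursiveWord J P (partFilter J P A (A.min' hA) \ P.part (A.min' hA)) j) ∨
    (P.part j ≠ P.part (A.min' hA) ∧
      ¬ ReflTransGen (PartRel J P) (P.part (A.min' hA)) (P.part j) ∧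
      j ∈ A \ partFilter J P A (A.min' hA) ∧
      #(partFilter J P A (A.min' hA)) < recursiveWord J P A j ∧
      recursiveWord J P A j = #(partFilter J P A (A.min' hA)) +
        recursiveWord J P (A \ partFilter J P A (A.min' hA)) j) := by
  by_cases hja : P.part j = P.part (A.min' hA)
  · exact Or.inl ⟨hja, recursiveWord_bounds_of_mem_part hsat hA hja⟩
  by_cases hjX : j ∈ partFilter J P A (A.min' hA)
  · have he := recursiveWord_of_mem_partFilter hA hja hjX
    have hm : j ∈ partFilter J P A (A.min' hA) \ P.part (A.min' hA) :=
      mem_sdiff.2 ⟨hjX, mt mem_part_iff.1 hja⟩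
    exact Or.inr (Or.inl ⟨hja, (mem_partFilter_iff.1 hjX).2, hm,
      he ▸ (recursiveWord_mem_Icc (hsat.partFilter_sdiff _) j hm).2, he⟩)
  · have he := recursiveWord_of_notMem_partFilter hA hja hjX
    have hm : j ∈ A \ partFilter J P A (A.min' hA) := mem_sdiff.2 ⟨hj, hjX⟩
    have := (recursiveWord_mem_Icc (J := J) (hsat.sdiff_partFilter (J := J) (A.min' hA)) j hm).1
    exact Or.inr (Or.inr ⟨hja, fun h => hjX (mem_partFilter_iff.2 ⟨hj, h⟩), hm, by omega, he⟩)

theorem recursiveWord_injOn {A : Finset (Fin n)} (hsat : Saturated P A) :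
    ∀ x ∈ A, ∀ y ∈ A, recursiveWord J P A x = recursiveWord J P A y → x = y := by
  induction A using Finset.strongInduction with
  | _ A ih =>
  intro x hx y hy hxy
  have hA : A.Nonempty := ⟨x, hx⟩
  have hle : #(partFilter J P A (A.min' hA) \ P.part (A.min' hA)) ≤
      #(partFilter J P A (A.min' hA)) := card_le_card sdiff_subset
  rcases recursiveWord_cases (J := J) hsat hA hx with ⟨hx1, hx2, hx3⟩ |
    ⟨hx1, hx2, hx3, hx4, hx5⟩ | ⟨hx1, hx2, hx3, hx4, hx5⟩ <;>
  rcases recursiveWord_cases (J := J) hsat hA hy with ⟨hy1, hy2, hy3⟩ |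
    ⟨hy1, hy2, hy3, hy4, hy5⟩ | ⟨hy1, hy2, hy3, hy4, hy5⟩ <;> try omega
  · rcases lt_trichotomy x y with h | h | h
    · exact absurd hxy (recursiveWord_lt_of_mem_part hsat hA hx1 hy1 h).ne'
    · exact h
    · exact absurd hxy (recursiveWord_lt_of_mem_part hsat hA hy1 hx1 h).ne
  · exact ih _ (partFilter_sdiff_part_ssubset hA) (hsat.partFilter_sdiff _) x hx3 y hy3
      (by omega)
  · exact ih _ (sdiff_partFilter_ssubset hA) (hsat.sdiff_partFilter _) x hx3 y hy3 (by omega)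

/-- The recursive word increases inside each region. -/
theorem recursiveWord_lt_of_sameRegion (hP : P ∈ noncrossing J) {A : Finset (Fin n)}
    (hsat : Saturated P A) : ∀ x ∈ A, ∀ y ∈ A, x < y → SameRegion J x y →
      recursiveWord J P A x < recursiveWord J P A y := by
  induction A using Finset.strongInduction with
  | _ A ih =>
  intro x hx y hy hxy hs
  have hA : A.Nonempty := ⟨x, hx⟩
  have hle : #(partFilter J P A (A.min' hA) \ P.part (A.min' hA)) ≤
      #(partFilter J P A (A.min' hA)) := card_le_card sdiff_subset
  have hmain : ReflTransGen (PartRel J P) (P.part (A.min' hA)) (P.part y) →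
      ReflTransGen (PartRel J P) (P.part (A.min' hA)) (P.part x) ∧
        P.part x ≠ P.part (A.min' hA) := fun hr => by
    rcases reflTransGen_of_sameRegion hP hr hxy hs with h | ⟨x', hx', hlt⟩
    · exact h
    · exact absurd (A.min'_le x' (hsat x hx x' hx')) (not_le.2 (hlt _ rfl))
  rcases recursiveWord_cases (J := J) hsat hA hx with ⟨hx1, hx2, hx3⟩ |
    ⟨hx1, hx2, hx3, hx4, hx5⟩ | ⟨hx1, hx2, hx3, hx4, hx5⟩ <;>
  rcases recursiveWord_cases (J := J) hsat hA hy with ⟨hy1, hy2, hy3⟩ |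
    ⟨hy1, hy2, hy3, hy4, hy5⟩ | ⟨hy1, hy2, hy3, hy4, hy5⟩ <;> try omega
  · exact absurd hx1 (hmain (hy1 ▸ .refl)).2
  · exact absurd hx1 (hmain hy2).2
  · rw [hx5, hy5]
    exact ih _ (partFilter_sdiff_part_ssubset hA) (hsat.partFilter_sdiff _) x hx3 y hy3 hxy hs
  · exact absurd (hmain (hy1 ▸ .refl)).1 hx2
  · exact absurd (hmain hy2).1 hx2
  · have := ih _ (sdiff_partFilter_ssubset hA) (hsat.sdiff_partFilter _) x hx3 y hy3 hxy hs
    omega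

theorem recursiveWord_lt_of_partRel {A : Finset (Fin n)} (hsat : Saturated P A) :
    ∀ x ∈ A, ∀ y ∈ A, PartRel J P (P.part x) (P.part y) →
      recursiveWord J P A y < recursiveWord J P A x := by
  induction A using Finset.strongInduction with
  | _ A ih =>
  intro x hx y hy hr
  have hA : A.Nonempty := ⟨x, hx⟩
  have hle : #(partFilter J P A (A.min' hA) \ P.part (A.min' hA)) ≤
      #(partFilter J P A (A.min' hA)) := card_le_card sdiff_subset
  have hy0 : P.part y ≠ P.part (A.min' hA) := fun he => by
    obtain ⟨z, hz, hlt⟩ := hr.exists_lt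
    have hzA := hsat x hx z (mem_part_iff.1 hz)
    exact absurd (A.min'_le z hzA) (not_le.2 (hlt _ (mem_part_iff.2 he.symm)))
  rcases recursiveWord_cases (J := J) hsat hA hx with ⟨hx1, hx2, hx3⟩ |
    ⟨hx1, hx2, hx3, hx4, hx5⟩ | ⟨hx1, hx2, hx3, hx4, hx5⟩ <;>
  rcases recursiveWord_cases (J := J) hsat hA hy with ⟨hy1, hy2, hy3⟩ |
    ⟨hy1, hy2, hy3, hy4, hy5⟩ | ⟨hy1, hy2, hy3, hy4, hy5⟩ <;> try omega
  all_goals try exact absurd hy1 hy0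
  · rw [hx1] at hr
    exact absurd (.single hr) hy2
  · rw [hx5, hy5]
    exact ih _ (partFilter_sdiff_part_ssubset hA) (hsat.partFilter_sdiff _) x hx3 y hy3 hr
  · exact absurd (hx2.tail hr) hy2
  · have := ih _ (sdiff_partFilter_ssubset hA) (hsat.sdiff_partFilter _) x hx3 y hy3 hr
    omega

theorem recursiveWord_of_mem_bumps {A : Finset (Fin n)} (hsat : Saturated P A) {x y : Fin n}
    (hb : (x, y) ∈ bumps P) (hx : x ∈ A) :
    recursiveWord J P A x = recursiveWord J P A y + 1 := by
  induction A using Finset.strongInduction with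
  | _ A ih =>
  have hA : A.Nonempty := ⟨x, hx⟩
  have hxy := bumps_part hb
  have hy : y ∈ A := hsat x hx y hxy.symm
  rcases recursiveWord_cases (J := J) hsat hA hx with ⟨hx1, hx2, hx3⟩ |
    ⟨hx1, hx2, hx3, hx4, hx5⟩ | ⟨hx1, hx2, hx3, hx4, hx5⟩ <;>
  rcases recursiveWord_cases (J := J) hsat hA hy with ⟨hy1, hy2, hy3⟩ |
    ⟨hy1, hy2, hy3, hy4, hy5⟩ | ⟨hy1, hy2, hy3, hy4, hy5⟩ <;> rw [hxy] at hx1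
  all_goals try exact absurd hx1 hy1
  all_goals try exact absurd hy1 hx1
  · have hx1' := hxy.trans hx1
    rw [recursiveWord_of_mem_part hA hy1] at hy2 ⊢
    rw [recursiveWord_of_mem_part hA hx1']
    have hset : ({c ∈ P.part (A.min' hA) | c < y} : Finset (Fin n)) =
        insert x {c ∈ P.part (A.min' hA) | c < x} := by
      ext c
      simp only [mem_filter, mem_insert, mem_part_iff]
      constructor
      · rintro ⟨hc, hcy⟩
        by_cases hcx : c < x
        · exact Or.inr ⟨hc, hcx⟩
        · refine Or.inl (by_contra fun hne => ?_)
          exact bumps_part_ne hb (lt_of_le_of_ne (not_lt.1 hcx) (Ne.symm hne)) hcy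
            (hc.trans hx1'.symm)
      · rintro (rfl | ⟨hc, hcx⟩)
        · exact ⟨hx1', bumps_lt hb⟩
        · exact ⟨hc, hcx.trans (bumps_lt hb)⟩
    have hcard := congrArg card hset
    rw [card_insert_of_notMem (by simp)] at hcard
    omega
  · rw [hx5, hy5]
    exact ih _ (partFilter_sdiff_part_ssubset hA) (hsat.partFilter_sdiff _) hx3
  · exact absurd (hxy ▸ hx2) hy2
  · exact absurd (hxy ▸ hy2) hx2
  · rw [hx5, hy5, ih _ (sdiff_partFilter_ssubset hA) (hsat.sdiff_partFilter _) hx3]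
    rfl

/-- `A` contains every part between two of its parts, in the order on parts. -/
def OrderConvex (J : Set (Equiv.Perm (Fin n))) (P : Finpartition (univ : Finset (Fin n)))
    (A : Finset (Fin n)) : Prop :=
  ∀ x ∈ A, ∀ z ∈ A, ∀ y, ReflTransGen (PartRel J P) (P.part x) (P.part y) →
    ReflTransGen (PartRel J P) (P.part y) (P.part z) → y ∈ A

/-- The recursive word has no descents other than the bumps of the partition. -/
theorem mem_bumps_of_recursiveWord {A : Finset (Fin n)} (hsat : Saturated P A)
    (hconv : OrderConvex J P A) :
    ∀ x ∈ A, ∀ y ∈ A, x < y → recursiveWord J P A x = recursiveWord J P A y + 1 →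
      (x, y) ∈ bumps P := by
  induction A using Finset.strongInduction with
  | _ A ih =>
  intro x hx y hy hxy heq
  have hA : A.Nonempty := ⟨x, hx⟩
  have hle : #(partFilter J P A (A.min' hA) \ P.part (A.min' hA)) ≤
      #(partFilter J P A (A.min' hA)) := card_le_card sdiff_subset
  rcases recursiveWord_cases (J := J) hsat hA hx with ⟨hx1, hx2, hx3⟩ |
    ⟨hx1, hx2, hx3, hx4, hx5⟩ | ⟨hx1, hx2, hx3, hx4, hx5⟩ <;>
  rcases recursiveWord_cases (J := J) hsat hA hy with ⟨hy1, hy2, hy3⟩ |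
    ⟨hy1, hy2, hy3, hy4, hy5⟩ | ⟨hy1, hy2, hy3, hy4, hy5⟩ <;> try omega
  · obtain ⟨c, hc, hb⟩ := exists_bump_right hxy (hx1.trans hy1.symm)
    rcases eq_or_lt_of_le hc with rfl | hlt
    · exact hb
    · have h1 := recursiveWord_of_mem_bumps (J := J) hsat hb hx
      have h2 := recursiveWord_lt_of_mem_part (J := J) hsat hA
        ((bumps_part hb).symm.trans hx1) hy1 hlt
      omega
  · -- `y` has the top value below the part `P̄` of the minimum, so it starts its part, and that part
    -- covers `P̄`: a bump of `P̄` passes over `y`, while `x` is the last element of `P̄`.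
    exfalso
    have hymin : ∀ c, P.part c = P.part y → y ≤ c := by
      intro c hc
      by_contra hcy
      obtain ⟨p, -, hb⟩ := exists_bump_left (not_le.1 hcy) hc
      have hp := (hsat.partFilter_sdiff (J := J) _) y hy3 p (bumps_part hb)
      have h1 := recursiveWord_of_mem_bumps (J := J) (hsat.partFilter_sdiff (J := J) _) hb hp
      have h2 := recursiveWord_mem_Icc (J := J) (hsat.partFilter_sdiff (J := J) _) p hp
      omega
    rcases ReflTransGen.cases_tail hy2 with h | ⟨D, hD, hr⟩
    · exact hy1 h
    obtain ⟨d, hd⟩ := P.nonempty_of_mem_parts hr.1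
    obtain rfl := P.part_eq_of_mem hr.1 hd
    by_cases hda : P.part d = P.part (A.min' hA)
    · obtain ⟨-, -, p, q, m, hb, hp, -, hm, h1, h2, -⟩ := hr
      have hmy : m = y := le_antisymm (hm.2 (mem_coe.2 (mem_part_iff.2 rfl)))
        (hymin m (mem_part_iff.1 (mem_coe.1 hm.1)))
      subst hmy
      have hp' := (mem_part_iff.1 hp).trans hda
      have hq' := (bumps_part hb).symm.trans hp'
      have h3 := recursiveWord_lt_of_mem_part (J := J) hsat hA hx1 hq' (hxy.trans h2)
      have h4 := recursiveWord_bounds_of_mem_part (J := J) hsat hA hq'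
      omega
    · have hdA := hconv _ (A.min'_mem hA) y hy d hD (.single hr)
      have hdX : d ∈ partFilter J P A (A.min' hA) \ P.part (A.min' hA) :=
        mem_sdiff.2 ⟨mem_partFilter_iff.2 ⟨hdA, hD⟩, mt mem_part_iff.1 hda⟩
      have h1 := recursiveWord_lt_of_partRel (hsat.partFilter_sdiff (J := J) _) d hdX y hy3 hr
      have h2 := (recursiveWord_mem_Icc (J := J) (hsat.partFilter_sdiff (J := J) _) d hdX).2
      omega
  · refine ih _ (partFilter_sdiff_part_ssubset hA) (hsat.partFilter_sdiff _) ?_ x hx3 y hy3 hxy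
      (by omega)
    intro u hu v hv z huz hzv
    rw [mem_sdiff, mem_partFilter_iff, mem_part_iff] at hu hv ⊢
    refine ⟨⟨hconv u hu.1.1 v hv.1.1 z huz hzv, hu.1.2.trans huz⟩, fun hz => hu.2 ?_⟩
    rw [hz] at huz
    exact reflTransGen_partRel_antisymm huz hu.1.2
  · exfalso
    -- `y` has the top value of the order filter, so it is the minimum of `A`
    have hay : A.min' hA = y := by
      by_contra hne
      have h1 := recursiveWord_lt_of_mem_part (J := J) hsat hA rfl hy1
        (lt_of_le_of_ne (A.min'_le y hy) hne)
      have h2 := recursiveWord_bounds_of_mem_part (J := J) hsat hA rfl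
      omega
    exact absurd (A.min'_le x hx) (not_le.2 (hay ▸ hxy))
  · exfalso
    have hpos : #(partFilter J P A (A.min' hA) \ P.part (A.min' hA)) <
        #(partFilter J P A (A.min' hA)) :=
      card_lt_card ((ssubset_iff_of_subset sdiff_subset).2
        ⟨A.min' hA, min'_mem_partFilter hA, fun h => (mem_sdiff.1 h).2 (mem_part_iff.2 rfl)⟩)
    omega
  · refine ih _ (sdiff_partFilter_ssubset hA) (hsat.sdiff_partFilter _) ?_ x hx3 y hy3 hxy
      (by omega)
    intro u hu v hv z huz hzv
    rw [mem_sdiff, mem_partFilter_iff] at hu hv ⊢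
    have hz := hconv u hu.1 v hv.1 z huz hzv
    exact ⟨hz, fun h => hv.2 ⟨hv.1, h.2.trans hzv⟩⟩

/-- The recursive word of a noncrossing partition is an avoiding permutation with the bumps of the
partition as descents. -/
theorem exists_avoiding231_of_noncrossing (hP : P ∈ noncrossing J) :
    ∃ w ∈ avoiding231 J, des w = bumps P := by
  have hsat : Saturated P univ := fun _ _ _ _ => mem_univ _
  have hbd := fun j => recursiveWord_mem_Icc (J := J) hsat j (mem_univ j)
  have hcard : #(univ : Finset (Fin n)) = n := by simp
  let f : Fin n → Fin n := fun j => ⟨recursiveWord J P univ j - 1, by have := hbd j; omega⟩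
  have hf : Function.Injective f := fun x y h =>
    recursiveWord_injOn (J := J) hsat x (mem_univ _) y (mem_univ _) (by
      have h1 := hbd x
      have h2 := hbd y
      have h3 := Fin.val_eq_of_eq h
      simp only [f] at h3
      omega)
  let w : Equiv.Perm (Fin n) := Equiv.ofBijective f (Finite.injective_iff_bijective.1 hf)
  have hw : ∀ j, (w j).val + 1 = recursiveWord J P univ j := fun j => by
    have := hbd j
    simp only [w, Equiv.ofBijective_apply, f]
    omega
  have hdes : des w = bumps P := by
    ext ⟨x, y⟩
    rw [mem_des_iff]
    have h1 := hw x
    have h2 := hw y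
    constructor
    · rintro ⟨hxy, h⟩
      exact mem_bumps_of_recursiveWord (J := J) hsat (fun _ _ _ _ _ _ _ => mem_univ _) x
        (mem_univ _) y (mem_univ _) hxy (by omega)
    · intro h
      have := recursiveWord_of_mem_bumps (J := J) hsat h (mem_univ _)
      exact ⟨bumps_lt h, by omega⟩
  have hmono : ∀ x y : Fin n, x < y → SameRegion J x y → w x < w y := fun x y hxy hs => by
    have := recursiveWord_lt_of_sameRegion hP hsat x (mem_univ _) y (mem_univ _) hxy hs
    have h1 := hw x
    have h2 := hw y
    exact Fin.lt_def.2 (by omega)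
  refine ⟨w, ⟨mem_parabolicQuotient_iff.2 hmono, ?_⟩, hdes⟩
  rintro ⟨i, j, k, hij, hjk, hsij, -, -, -, hlt, hval⟩
  have hb : (i, k) ∈ bumps P := hdes ▸ mem_des_iff.2 ⟨hij.trans hjk, hval⟩
  have hlt' := Fin.lt_def.1 hlt
  rcases partRel_or_exists hP hb hij hjk hsij with h | ⟨e, he, hes, hei⟩
  · have := recursiveWord_lt_of_partRel hsat i (mem_univ _) j (mem_univ _) h
    have h1 := hw i
    have h2 := hw j
    omega
  · exact lt_asymm (hmono e i hei hes) (lt_of_part_eq hdes.symm (bumps_part_ne hb hij hjk).symm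
      hlt rfl he)

theorem eq_of_des_eq {w w' : Equiv.Perm (Fin n)} (hw : w ∈ avoiding231 J)
    (hw' : w' ∈ avoiding231 J) (h : des w = des w') : w = w' := by
  obtain ⟨P, -, hP⟩ := exists_noncrossing_of_mem_avoiding231 hw
  ext j
  have h1 := recursiveWord_eq_of_avoiding hw hP univ 0 n le_rfl (by simp) (by simp) j (mem_univ _)
  have h2 := recursiveWord_eq_of_avoiding hw' (hP.trans h) univ 0 n le_rfl (by simp) (by simp) j
    (mem_univ _)
  omega

end

/-! ### Order ideals and nonnesting partitions -/

section
variable {n : ℕ} {J : Set (Equiv.Perm (Fin n))}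

/-- The pair `(i, j)` is a root that belongs to the order ideal `I`. -/
def InIdeal (I : LowerSet (ParabolicRoot J)) (i j : Fin n) : Prop :=
  ∃ t ∈ I, t.1.fst = i ∧ t.1.snd = j

theorem InIdeal.regionIndex_lt {I : LowerSet (ParabolicRoot J)} {i j : Fin n}
    (h : InIdeal I i j) : regionIndex J i < regionIndex J j := by
  obtain ⟨t, -, rfl, rfl⟩ := h
  exact (not_sameRegion_iff t.1.lt.le).1 (mem_parabolicRoots_iff.1 t.2)

theorem mem_iff_inIdeal {I : LowerSet (ParabolicRoot J)} {t : ParabolicRoot J} :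
    t ∈ I ↔ InIdeal I t.1.fst t.1.snd := by
  refine ⟨fun h => ⟨t, h, rfl, rfl⟩, ?_⟩
  rintro ⟨s, hs, h1, h2⟩
  exact (Subtype.ext (Root.ext h1 h2) : s = t) ▸ hs

/-- The root with ends `i` and `j` in different regions. -/
def rootOf {i j : Fin n} (h : regionIndex J i < regionIndex J j) : ParabolicRoot J :=
  ⟨⟨i, j, lt_of_regionIndex_lt h⟩,
    mem_parabolicRoots_iff.2 ((not_sameRegion_iff (lt_of_regionIndex_lt h).le).2 h)⟩

theorem InIdeal.mono {I : LowerSet (ParabolicRoot J)} {i j i' j' : Fin n} (h : InIdeal I i j)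
    (hi : i ≤ i') (hj : j' ≤ j) (hlt : regionIndex J i' < regionIndex J j') :
    InIdeal I i' j' := by
  obtain ⟨t, ht, rfl, rfl⟩ := h
  exact ⟨rootOf hlt, I.lower (show rootOf hlt ≤ t from ⟨hi, hj⟩) ht, rfl, rfl⟩

theorem lowerSet_ext {I I' : LowerSet (ParabolicRoot J)}
    (h : ∀ i j, InIdeal I i j ↔ InIdeal I' i j) : I = I' :=
  SetLike.ext fun t => by rw [mem_iff_inIdeal, mem_iff_inIdeal, h]

/-- The order ideal of the roots whose ends satisfy `p`. -/
def idealOf (p : Fin n → Fin n → Prop)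
    (hp : ∀ i j i' j', p i j → i ≤ i' → j' ≤ j → regionIndex J i' < regionIndex J j' → p i' j') :
    LowerSet (ParabolicRoot J) where
  carrier := {t | p t.1.fst t.1.snd}
  lower' := fun _ t hts hs => hp _ _ _ _ hs hts.1 hts.2
    ((not_sameRegion_iff t.1.lt.le).1 (mem_parabolicRoots_iff.1 t.2))

theorem inIdeal_idealOf {p : Fin n → Fin n → Prop}
    {hp : ∀ i j i' j', p i j → i ≤ i' → j' ≤ j → regionIndex J i' < regionIndex J j' → p i' j'}
    {i j : Fin n} : InIdeal (idealOf p hp) i j ↔ regionIndex J i < regionIndex J j ∧ p i j := by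
  constructor
  · intro h
    refine ⟨h.regionIndex_lt, ?_⟩
    obtain ⟨t, ht, rfl, rfl⟩ := h
    exact ht
  · rintro ⟨hlt, h⟩
    exact ⟨rootOf hlt, h, rfl, rfl⟩

instance : Finite (Root n) :=
  Finite.of_injective (fun t : Root n => (t.fst, t.snd)) fun _ _ h =>
    Root.ext (congrArg Prod.fst h) (congrArg Prod.snd h)

theorem mem_minimalComplement_iff {I : LowerSet (ParabolicRoot J)} {i j : Fin n} :
    (i, j) ∈ minimalComplement I ↔ regionIndex J i < regionIndex J j ∧ ¬ InIdeal I i j ∧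
      ∀ i' j', regionIndex J i' < regionIndex J j' → i ≤ i' → j' ≤ j → ¬ InIdeal I i' j' →
        i' = i ∧ j' = j := by
  constructor
  · rintro ⟨t, ht, h⟩
    obtain ⟨rfl, rfl⟩ := Prod.mk.inj h
    refine ⟨(not_sameRegion_iff t.1.lt.le).1 (mem_parabolicRoots_iff.1 t.2),
      fun h => ht.1 (mem_iff_inIdeal.2 h), fun i' j' hlt hi hj hn => ?_⟩
    have hle : rootOf hlt ≤ t := ⟨hi, hj⟩
    have hge : t ≤ rootOf hlt := ht.2 (fun h => hn (mem_iff_inIdeal.1 h)) hle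
    exact ⟨le_antisymm hge.1 hi, le_antisymm hj hge.2⟩
  · rintro ⟨hlt, hn, hmin⟩
    refine ⟨rootOf hlt, ⟨fun h => hn (mem_iff_inIdeal.1 h), fun s hs hle => ?_⟩, rfl⟩
    obtain ⟨h1, h2⟩ := hmin s.1.fst s.1.snd
      ((not_sameRegion_iff s.1.lt.le).1 (mem_parabolicRoots_iff.1 s.2)) hle.1 hle.2
      fun h => hs (mem_iff_inIdeal.2 h)
    exact ⟨le_of_eq h1, le_of_eq h2.symm⟩

theorem exists_mem_minimalComplement {I : LowerSet (ParabolicRoot J)} {i j : Fin n}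
    (hlt : regionIndex J i < regionIndex J j) (h : ¬ InIdeal I i j) :
    ∃ i' j', (i', j') ∈ minimalComplement I ∧ i ≤ i' ∧ j' ≤ j := by
  obtain ⟨t, htle, ht⟩ := exists_minimal_le_of_wellFoundedLT (fun s : ParabolicRoot J => s ∉ I)
    (rootOf hlt) (fun hm => h (mem_iff_inIdeal.1 hm))
  exact ⟨t.1.fst, t.1.snd, ⟨t, ht, rfl⟩, htle.1, htle.2⟩

theorem minimalComplement_injective :
    Function.Injective (minimalComplement : LowerSet (ParabolicRoot J) → Set (Fin n × Fin n)) := by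
  have key : ∀ I I' : LowerSet (ParabolicRoot J), minimalComplement I = minimalComplement I' →
      ∀ i j, InIdeal I i j → InIdeal I' i j := by
    intro I I' h i j hij
    by_contra hn
    obtain ⟨i', j', hm, hi, hj⟩ := exists_mem_minimalComplement hij.regionIndex_lt hn
    rw [← h, mem_minimalComplement_iff] at hm
    exact hm.2.1 (hij.mono hi hj hm.1)
  exact fun I I' h => lowerSet_ext fun i j => ⟨key I I' h i j, key I' I h.symm i j⟩

theorem exists_ideal_of_nonnesting {Q : Finpartition (univ : Finset (Fin n))}
    (hQ : Q ∈ nonnesting J) : ∃ I : LowerSet (ParabolicRoot J), bumps Q = minimalComplement I := by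
  let p : Fin n → Fin n → Prop := fun i j => ∀ a b, (a, b) ∈ bumps Q → i ≤ a → ¬ b ≤ j
  have hp : ∀ i j i' j', p i j → i ≤ i' → j' ≤ j → regionIndex J i' < regionIndex J j' →
      p i' j' := fun i j i' j' h hi hj _ a b hb ha hbj => h a b hb (hi.trans ha) (hbj.trans hj)
  have hlt : ∀ a b, (a, b) ∈ bumps Q → regionIndex J a < regionIndex J b := fun a b hb =>
    (not_sameRegion_iff (bumps_lt hb).le).1 (transversal_iff.1 hQ.1 a b hb)
  have hanti : ∀ a b a' b', (a, b) ∈ bumps Q → (a', b') ∈ bumps Q → a ≤ a' → b' ≤ b →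
      a' = a ∧ b' = b := by
    intro a b a' b' hb hb' ha hbb
    rcases eq_or_lt_of_le ha with rfl | ha
    · exact ⟨rfl, bumps_right_unique hb' hb⟩
    rcases eq_or_lt_of_le hbb with rfl | hbb
    · exact ⟨bumps_left_unique hb' hb, rfl⟩
    exact absurd ⟨ha, bumps_lt hb', hbb⟩ (hQ.2 a b a' b' hb hb')
  refine ⟨idealOf p hp, Set.ext fun ⟨i, j⟩ => ?_⟩
  rw [mem_minimalComplement_iff]
  simp only [inIdeal_idealOf, not_and]
  constructor
  · intro hb
    refine ⟨hlt i j hb, fun _ h => h i j hb le_rfl le_rfl, fun i' j' hij hi hj hn => ?_⟩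
    have hn' := hn hij
    simp only [p, not_forall, not_not] at hn'
    obtain ⟨a, b, hab, hia, hbj⟩ := hn'
    obtain ⟨rfl, rfl⟩ := hanti i j a b hb hab (hi.trans hia) (hbj.trans hj)
    exact ⟨le_antisymm hia hi, le_antisymm hj hbj⟩
  · rintro ⟨hij, hn, hmin⟩
    have hn' := hn hij
    simp only [p, not_forall, not_not] at hn'
    obtain ⟨a, b, hab, hia, hbj⟩ := hn'
    obtain ⟨rfl, rfl⟩ := hmin a b (hlt a b hab) hia hbj fun _ h => h a b hab le_rfl le_rfl
    exact hab

theorem exists_nonnesting_of_ideal (I : LowerSet (ParabolicRoot J)) :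
    ∃ Q ∈ nonnesting J, bumps Q = minimalComplement I := by
  have hanti : ∀ a b a' b', (a, b) ∈ minimalComplement I → (a', b') ∈ minimalComplement I →
      a ≤ a' → b' ≤ b → a' = a ∧ b' = b := fun a b a' b' h h' ha hb => by
    rw [mem_minimalComplement_iff] at h h'
    exact h.2.2 a' b' h'.1 ha hb h'.2.1
  obtain ⟨Q, hQ⟩ := exists_bumps_eq (minimalComplement I)
    (fun a b h => lt_of_regionIndex_lt (mem_minimalComplement_iff.1 h).1)
    (fun a b b' h h' => by
      rcases le_total b b' with hb | hb
      · exact (hanti _ _ _ _ h' h le_rfl hb).2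
      · exact (hanti _ _ _ _ h h' le_rfl hb).2.symm)
    (fun a a' b h h' => by
      rcases le_total a a' with ha | ha
      · exact (hanti _ _ _ _ h h' ha le_rfl).1.symm
      · exact (hanti _ _ _ _ h' h ha le_rfl).1)
  refine ⟨Q, ⟨transversal_iff.2 fun a b hab => ?_, ?_⟩, hQ⟩
  · rw [hQ, mem_minimalComplement_iff] at hab
    exact fun h => hab.1.ne h
  · rw [hQ]
    rintro i₁ i₂ j₁ j₂ hi hj ⟨h1, h2, h3⟩
    exact h1.ne' (hanti _ _ _ _ hi hj h1.le h3.le).1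

end

/-! ### Order-reversing matchings -/

section
variable {n : ℕ} {C L : Finset (Fin n)}

theorem exists_reverseMatch_eq (h : #C = #L) {j : Fin n} (hj : j ∈ C) :
    ∃ hk : #{c ∈ C | c < j} < (L.sort (fun a b => b ≤ a)).length,
      reverseMatch C L j = (L.sort (fun a b => b ≤ a))[#{c ∈ C | c < j}] := by
  have hk : #{c ∈ C | c < j} < (L.sort (fun a b => b ≤ a)).length := by
    rw [length_sort, ← h]
    exact card_lt_card ((ssubset_iff_of_subset (filter_subset _ _)).2 ⟨j, hj, by simp⟩)
  exact ⟨hk, by rw [reverseMatch, List.getD_eq_getElem _ _ hk]⟩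

theorem reverseMatch_mem (h : #C = #L) {j : Fin n} (hj : j ∈ C) : reverseMatch C L j ∈ L := by
  obtain ⟨hk, he⟩ := exists_reverseMatch_eq h hj
  rw [he]
  exact (mem_sort (fun a b => b ≤ a)).1 (List.getElem_mem hk)

theorem reverseMatch_lt (h : #C = #L) {i j : Fin n} (hi : i ∈ C) (hj : j ∈ C) (hij : i < j) :
    reverseMatch C L j < reverseMatch C L i := by
  obtain ⟨hk, he⟩ := exists_reverseMatch_eq h hi
  obtain ⟨hk', he'⟩ := exists_reverseMatch_eq h hj
  rw [he, he']
  have hlt : #{c ∈ C | c < i} < #{c ∈ C | c < j} := by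
    refine card_lt_card ((ssubset_iff_of_subset fun c hc => ?_).2 ⟨i, ?_, by simp⟩)
    · rw [mem_filter] at hc ⊢
      exact ⟨hc.1, hc.2.trans hij⟩
    · exact mem_filter.2 ⟨hi, hij⟩
  exact sortedGT_sort L hlt

theorem reverseMatch_injOn (h : #C = #L) : Set.InjOn (reverseMatch C L) C := by
  intro i hi j hj hij
  rcases lt_trichotomy i j with hlt | rfl | hlt
  · exact absurd hij (reverseMatch_lt h hi hj hlt).ne'
  · rfl
  · exact absurd hij (reverseMatch_lt h hj hi hlt).ne

theorem reverseMatch_surjOn (h : #C = #L) {l : Fin n} (hl : l ∈ L) :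
    ∃ j ∈ C, reverseMatch C L j = l := by
  have himg : C.image (reverseMatch C L) = L := by
    refine eq_of_subset_of_card_le (image_subset_iff.2 fun j hj => reverseMatch_mem h hj) ?_
    rw [card_image_of_injOn (reverseMatch_injOn h), h]
  rw [← himg] at hl
  simpa using hl

end

/-! ### Chosen columns and their labels -/

section
variable {n : ℕ} {J : Set (Equiv.Perm (Fin n))} {I I' : LowerSet (ParabolicRoot J)}

theorem regionIndex_lt (i : Fin n) : regionIndex J i < n := by
  have h : regionIndex J i < #(univ : Finset (Fin n)) := by
    refine card_lt_card ((ssubset_iff_of_subset (subset_univ _)).2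
      ⟨⟨0, i.pos⟩, mem_univ _, ?_⟩)
    simp only [mem_filter, mem_univ, true_and, not_and]
    rintro - ⟨a, ha, -⟩
    simp at ha
  simpa using h

/-- Downward induction over the regions. -/
@[elab_as_elim]
theorem region_induction {motive : ℕ → Prop} (hbase : ∀ m, n ≤ m → motive m)
    (hstep : ∀ m, motive (m + 1) → motive m) (m : ℕ) : motive m := by
  have key : ∀ k m, n - m = k → motive m := by
    intro k
    induction k with
    | zero => exact fun m hm => hbase m (by omega)
    | succ k ih => exact fun m hm => hstep m (ih (m + 1) (by omega))
  exact key _ m rfl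

theorem mem_supported_iff {m : ℕ} {j : Fin n} : j ∈ supported I m ↔
    ∃ b, IsLeast (region J (m + 1) : Set (Fin n)) b ∧ InIdeal I b j := by
  simp [supported, InIdeal]

theorem regionIndex_of_isLeast {m : ℕ} {b : Fin n} (h : IsLeast (region J m : Set (Fin n)) b) :
    regionIndex J b = m :=
  mem_region.1 (mem_coe.1 h.1)

theorem le_of_isLeast_region {m : ℕ} {b i : Fin n}
    (h : IsLeast (region J m : Set (Fin n)) b) (hi : m ≤ regionIndex J i) : b ≤ i := by
  rcases eq_or_lt_of_le hi with he | hlt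
  · exact h.2 (mem_coe.2 (mem_region.2 he.symm))
  · exact (lt_of_regionIndex_lt (by rwa [regionIndex_of_isLeast h])).le

theorem regionIndex_of_mem_supported {m : ℕ} {j : Fin n} (h : j ∈ supported I m) :
    m + 1 < regionIndex J j := by
  obtain ⟨b, hb, hj⟩ := mem_supported_iff.1 h
  exact regionIndex_of_isLeast hb ▸ hj.regionIndex_lt

theorem mem_chosenColumns_iff {m : ℕ} {j : Fin n} :
    j ∈ chosenColumns I m ↔ regionIndex J j = m + 1 ∨ j ∈ supported I m := by
  rw [chosenColumns, mem_union, mem_region]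

theorem regionIndex_of_mem_chosenColumns {m : ℕ} {j : Fin n} (h : j ∈ chosenColumns I m) :
    m < regionIndex J j := by
  rcases mem_chosenColumns_iff.1 h with h | h
  · omega
  · have := regionIndex_of_mem_supported h
    omega

/-- The chosen columns form an interval that starts with region `m + 1`. -/
theorem mem_chosenColumns_of_le {m : ℕ} {j j' : Fin n} (h : j ∈ chosenColumns I m)
    (hle : j' ≤ j) (hm : m < regionIndex J j') : j' ∈ chosenColumns I m := by
  rw [mem_chosenColumns_iff] at h ⊢
  by_cases he : regionIndex J j' = m + 1
  · exact Or.inl he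
  have hmono := regionIndex_mono (J := J) hle
  rcases h with h | h
  · omega
  · obtain ⟨b, hb, hj⟩ := mem_supported_iff.1 h
    exact Or.inr (mem_supported_iff.2 ⟨b, hb, hj.mono le_rfl hle (by
      rw [regionIndex_of_isLeast hb]; omega)⟩)

/-- In the rows of region `m`, the order ideal lives in the chosen columns. -/
theorem InIdeal.mem_chosenColumns {i j : Fin n} (h : InIdeal I i j) :
    j ∈ chosenColumns I (regionIndex J i) := by
  have hlt := h.regionIndex_lt
  rw [mem_chosenColumns_iff]
  by_cases he : regionIndex J j = regionIndex J i + 1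
  · exact Or.inl he
  obtain ⟨b, -, hb⟩ := exists_isLeast_region (J := J) (m := regionIndex J i + 1) (l := j) hlt
  have hbr := regionIndex_of_isLeast hb
  exact Or.inr (mem_supported_iff.2 ⟨b, hb, h.mono
    (lt_of_regionIndex_lt (J := J) (by omega)).le le_rfl (by omega)⟩)

theorem supported_subset_chosenColumns (m : ℕ) : supported I m ⊆ chosenColumns I (m + 1) := by
  intro j hj
  obtain ⟨b, hb, h⟩ := mem_supported_iff.1 hj
  exact regionIndex_of_isLeast hb ▸ h.mem_chosenColumns

/-- The labels that are available above the rows of region `m`. -/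
noncomputable def labels (I : LowerSet (ParabolicRoot J)) (m : ℕ) : Finset (Fin n) :=
  region J (m + 1) ∪ (supported I m).image (columnLabel I (m + 1))

theorem columnLabel_eq {m : ℕ} (h : m < n) (j : Fin n) :
    columnLabel I m j = reverseMatch (chosenColumns I m) (labels I m) j := by
  rw [columnLabel, if_pos h, labels]

theorem lt_of_mem_chosenColumns {m : ℕ} {j : Fin n} (h : j ∈ chosenColumns I m) : m < n :=
  (regionIndex_of_mem_chosenColumns h).trans (regionIndex_lt j)

theorem card_chosenColumns_and_labels (m : ℕ) :
    #(chosenColumns I m) = #(labels I m) ∧ ∀ l ∈ labels I m, m < regionIndex J l := by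
  refine region_induction (n := n) (fun m hm => ?_) (fun m ih => ?_) m
  · have h1 : region J (m + 1) = ∅ := by
      refine eq_empty_of_forall_notMem fun i hi => ?_
      have := mem_region.1 hi
      have := regionIndex_lt (J := J) i
      omega
    have h2 : supported I m = ∅ := by
      refine eq_empty_of_forall_notMem fun i hi => ?_
      have := regionIndex_of_mem_supported hi
      have := regionIndex_lt (J := J) i
      omega
    simp [chosenColumns, labels, h1, h2]
  · have hsub := supported_subset_chosenColumns (I := I) m
    have hmem : ∀ j ∈ supported I m, columnLabel I (m + 1) j ∈ labels I (m + 1) :=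
      fun j hj => by
        rw [columnLabel_eq (lt_of_mem_chosenColumns (hsub hj))]
        exact reverseMatch_mem ih.1 (hsub hj)
    have hinj : Set.InjOn (columnLabel I (m + 1)) (supported I m) := fun i hi j hj hij => by
      rw [columnLabel_eq (lt_of_mem_chosenColumns (hsub hi)),
        columnLabel_eq (lt_of_mem_chosenColumns (hsub hi))] at hij
      exact reverseMatch_injOn ih.1 (hsub hi) (hsub hj) hij
    constructor
    · rw [chosenColumns, labels, card_union_of_disjoint, card_union_of_disjoint,
        card_image_of_injOn hinj]
      · refine disjoint_left.2 fun l hl hl' => ?_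
        obtain ⟨j, hj, rfl⟩ := mem_image.1 hl'
        have h1 := ih.2 _ (hmem j hj)
        have h2 := mem_region.1 hl
        omega
      · refine disjoint_left.2 fun l hl hl' => ?_
        have h1 := regionIndex_of_mem_supported hl'
        have h2 := mem_region.1 hl
        omega
    · intro l hl
      rw [labels, mem_union] at hl
      rcases hl with hl | hl
      · have := mem_region.1 hl
        omega
      · obtain ⟨j, hj, rfl⟩ := mem_image.1 hl
        have h1 := ih.2 _ (hmem j hj)
        omega

theorem columnLabel_mem {m : ℕ} {j : Fin n} (hj : j ∈ chosenColumns I m) :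
    columnLabel I m j ∈ labels I m := by
  rw [columnLabel_eq (lt_of_mem_chosenColumns hj)]
  exact reverseMatch_mem (card_chosenColumns_and_labels m).1 hj

theorem columnLabel_lt {m : ℕ} {i j : Fin n} (hi : i ∈ chosenColumns I m)
    (hj : j ∈ chosenColumns I m) (hij : i < j) : columnLabel I m j < columnLabel I m i := by
  rw [columnLabel_eq (lt_of_mem_chosenColumns hj), columnLabel_eq (lt_of_mem_chosenColumns hj)]
  exact reverseMatch_lt (card_chosenColumns_and_labels m).1 hi hj hij

theorem columnLabel_injOn {m : ℕ} : Set.InjOn (columnLabel I m) (chosenColumns I m) := by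
  intro i hi j hj hij
  rcases lt_trichotomy i j with hlt | rfl | hlt
  · exact absurd hij (columnLabel_lt hi hj hlt).ne'
  · rfl
  · exact absurd hij (columnLabel_lt hj hi hlt).ne

theorem exists_columnLabel_eq {m : ℕ} {l : Fin n} (hl : l ∈ labels I m) :
    ∃ j ∈ chosenColumns I m, columnLabel I m j = l := by
  obtain ⟨j, hj, he⟩ := reverseMatch_surjOn (card_chosenColumns_and_labels m).1 hl
  exact ⟨j, hj, by rw [columnLabel_eq (lt_of_mem_chosenColumns hj), he]⟩

/-! ### The bumps built from an order ideal -/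

/-- `(i, j)` is a minimal root outside of `I` within the rows of region `m` and the chosen
columns. -/
def IsCorner (I : LowerSet (ParabolicRoot J)) (m : ℕ) (i j : Fin n) : Prop :=
  regionIndex J i = m ∧ j ∈ chosenColumns I m ∧ ¬ InIdeal I i j ∧
    ∀ i' j', regionIndex J i' = m → j' ∈ chosenColumns I m → i ≤ i' → j' ≤ j →
      ¬ InIdeal I i' j' → i' = i ∧ j' = j

theorem isCorner_iff_minimal {m : ℕ} {t : ParabolicRoot J} : IsCorner I m t.1.fst t.1.snd ↔
    Minimal (fun s : ParabolicRoot J => s ∉ I ∧ s.1.fst ∈ region J m ∧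
      s.1.snd ∈ chosenColumns I m) t := by
  simp only [mem_region, mem_iff_inIdeal]
  constructor
  · rintro ⟨h1, h2, h3, h4⟩
    refine ⟨⟨h3, h1, h2⟩, fun s hs hle => ?_⟩
    obtain ⟨h5, h6⟩ := h4 _ _ hs.2.1 hs.2.2 hle.1 hle.2 hs.1
    exact ⟨le_of_eq h5, le_of_eq h6.symm⟩
  · rintro ⟨⟨h3, h1, h2⟩, h4⟩
    refine ⟨h1, h2, h3, fun i' j' hi' hj' hi hj hn => ?_⟩
    have hlt : regionIndex J i' < regionIndex J j' :=
      hi' ▸ regionIndex_of_mem_chosenColumns hj'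
    have hge := h4 (y := rootOf hlt) ⟨hn, hi', hj'⟩ ⟨hi, hj⟩
    exact ⟨le_antisymm hge.1 hi, le_antisymm hj hge.2⟩

theorem IsCorner.regionIndex_lt {m : ℕ} {i j : Fin n} (h : IsCorner I m i j) :
    regionIndex J i < regionIndex J j :=
  h.1 ▸ regionIndex_of_mem_chosenColumns h.2.1

theorem exists_isCorner {m : ℕ} {i j : Fin n} (hi : regionIndex J i = m)
    (hj : j ∈ chosenColumns I m) (hn : ¬ InIdeal I i j) :
    ∃ i' j', IsCorner I m i' j' ∧ i ≤ i' ∧ j' ≤ j := by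
  have hlt : regionIndex J i < regionIndex J j := hi ▸ regionIndex_of_mem_chosenColumns hj
  obtain ⟨t, htle, ht⟩ := exists_minimal_le_of_wellFoundedLT
    (fun s : ParabolicRoot J => s ∉ I ∧ s.1.fst ∈ region J m ∧ s.1.snd ∈ chosenColumns I m)
    (rootOf hlt) ⟨fun hm => hn (mem_iff_inIdeal.1 hm), mem_region.2 hi, hj⟩
  exact ⟨t.1.fst, t.1.snd, isCorner_iff_minimal.2 ht, htle.1, htle.2⟩

theorem inIdeal_iff_isCorner {i j : Fin n} : InIdeal I i j ↔
    j ∈ chosenColumns I (regionIndex J i) ∧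
      ∀ i' j', IsCorner I (regionIndex J i) i' j' → i ≤ i' → ¬ j' ≤ j := by
  constructor
  · intro h
    exact ⟨h.mem_chosenColumns, fun i' j' hc hi hj => hc.2.2.1 (h.mono hi hj hc.regionIndex_lt)⟩
  · rintro ⟨h1, h2⟩
    by_contra hn
    obtain ⟨i', j', hc, hi, hj⟩ := exists_isCorner rfl h1 hn
    exact h2 i' j' hc hi hj

theorem IsCorner.eq_of_le {m : ℕ} {i j i' j' : Fin n} (h : IsCorner I m i j)
    (h' : IsCorner I m i' j') (hi : i ≤ i') (hj : j' ≤ j) : i' = i ∧ j' = j :=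
  h.2.2.2 i' j' h'.1 h'.2.1 hi hj h'.2.2.1

theorem IsCorner.right_unique {m : ℕ} {i j j' : Fin n} (h : IsCorner I m i j)
    (h' : IsCorner I m i j') : j = j' := by
  rcases le_total j j' with hj | hj
  · exact (h'.eq_of_le h le_rfl hj).2
  · exact (h.eq_of_le h' le_rfl hj).2.symm

theorem IsCorner.left_unique {m : ℕ} {i i' j : Fin n} (h : IsCorner I m i j)
    (h' : IsCorner I m i' j) : i = i' := by
  rcases le_total i i' with hi | hi
  · exact (h.eq_of_le h' hi le_rfl).1.symm
  · exact (h'.eq_of_le h hi le_rfl).1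

/-- The label of the row `i` of region `m`. -/
noncomputable def rowLabel (J : Set (Equiv.Perm (Fin n))) (m : ℕ) (i : Fin n) : Fin n :=
  reverseMatch (region J m) (region J m) i

theorem regionIndex_rowLabel {m : ℕ} {i : Fin n} (hi : regionIndex J i = m) :
    regionIndex J (rowLabel J m i) = m :=
  mem_region.1 (reverseMatch_mem rfl (mem_region.2 hi))

theorem rowLabel_lt {m : ℕ} {i i' : Fin n} (hi : regionIndex J i = m)
    (hi' : regionIndex J i' = m) (h : i < i') : rowLabel J m i' < rowLabel J m i :=
  reverseMatch_lt rfl (mem_region.2 hi) (mem_region.2 hi') h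

theorem rowLabel_inj {m : ℕ} {i i' : Fin n} (hi : regionIndex J i = m)
    (hi' : regionIndex J i' = m) (h : rowLabel J m i = rowLabel J m i') : i = i' :=
  reverseMatch_injOn rfl (mem_coe.2 (mem_region.2 hi)) (mem_coe.2 (mem_region.2 hi')) h

theorem exists_rowLabel_eq {m : ℕ} {a : Fin n} (ha : regionIndex J a = m) :
    ∃ i, regionIndex J i = m ∧ rowLabel J m i = a := by
  obtain ⟨i, hi, he⟩ := reverseMatch_surjOn (C := region J m) rfl (mem_region.2 ha)
  exact ⟨i, mem_region.1 hi, he⟩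

theorem mem_idealBumpsFrom_iff (m : ℕ) (a b : Fin n) : (a, b) ∈ idealBumpsFrom I m ↔
    m ≤ regionIndex J a ∧ ∃ i j, IsCorner I (regionIndex J a) i j ∧
      a = rowLabel J (regionIndex J a) i ∧ b = columnLabel I (regionIndex J a) j := by
  refine region_induction (n := n) (fun m hm => ?_) (fun m ih => ?_) m
  · rw [idealBumpsFrom, if_neg (not_lt.2 hm)]
    have := regionIndex_lt (J := J) a
    simp only [Set.mem_empty_iff_false, false_iff, not_and]
    omega
  · by_cases hm : m < n
    · rw [idealBumpsFrom, if_pos hm, Set.mem_union, ih]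
      constructor
      · rintro (⟨h1, h2⟩ | ⟨t, ht, he⟩)
        · exact ⟨by omega, h2⟩
        · obtain ⟨rfl, rfl⟩ := Prod.mk.inj he
          have hc := isCorner_iff_minimal.2 ht
          have hr := regionIndex_rowLabel hc.1
          rw [rowLabel] at hr
          rw [hr]
          exact ⟨le_rfl, _, _, hc, rfl, rfl⟩
      · rintro ⟨h1, h2⟩
        rcases eq_or_lt_of_le h1 with he | hlt
        · right
          rw [← he] at h2
          obtain ⟨i, j, hc, rfl, rfl⟩ := h2
          exact ⟨rootOf hc.regionIndex_lt,
            (isCorner_iff_minimal (t := rootOf hc.regionIndex_lt)).1 hc, rfl⟩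
        · exact Or.inl ⟨hlt, h2⟩
    · rw [idealBumpsFrom, if_neg hm]
      have := regionIndex_lt (J := J) a
      simp only [Set.mem_empty_iff_false, false_iff, not_and]
      omega

theorem mem_idealBumps_iff {a b : Fin n} : (a, b) ∈ idealBumps I ↔
    ∃ i j, IsCorner I (regionIndex J a) i j ∧
      a = rowLabel J (regionIndex J a) i ∧ b = columnLabel I (regionIndex J a) j := by
  rw [idealBumps, mem_idealBumpsFrom_iff]
  simp

theorem mem_idealBumps_of_isCorner {m : ℕ} {i j : Fin n} (h : IsCorner I m i j) :
    (rowLabel J m i, columnLabel I m j) ∈ idealBumps I := by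
  rw [mem_idealBumps_iff, regionIndex_rowLabel h.1]
  exact ⟨i, j, h, rfl, rfl⟩

theorem mem_labels_of_mem_idealBumps {a b : Fin n} (h : (a, b) ∈ idealBumps I) :
    b ∈ labels I (regionIndex J a) := by
  obtain ⟨i, j, hc, -, hb⟩ := mem_idealBumps_iff.1 h
  rw [hb]
  exact columnLabel_mem hc.2.1

theorem regionIndex_lt_of_mem_idealBumps {a b : Fin n} (h : (a, b) ∈ idealBumps I) :
    regionIndex J a < regionIndex J b :=
  (card_chosenColumns_and_labels _).2 b (mem_labels_of_mem_idealBumps h)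

/-- The available labels above region `m` are the elements to the right of region `m` that neither
end a bump from a later region, nor lie under such a bump that starts in another region than
theirs: exactly the possible ends of a bump from region `m` in a noncrossing partition. -/
theorem mem_labels_iff (m : ℕ) : ∀ l, l ∈ labels I m ↔ m < regionIndex J l ∧
    ∀ a b, (a, b) ∈ idealBumps I → m < regionIndex J a →
      b ≠ l ∧ ¬ (a < l ∧ l < b ∧ ¬ SameRegion J a l) := by
  refine region_induction (n := n) (fun m hm l => ?_) (fun m ih l => ?_) m
  · have := regionIndex_lt (J := J) l
    constructor
    · intro hl
      have := (card_chosenColumns_and_labels m).2 l hl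
      omega
    · rintro ⟨h, -⟩
      omega
  constructor
  · intro hl
    refine ⟨(card_chosenColumns_and_labels m).2 l hl, fun a b hab ha => ?_⟩
    have hab' := regionIndex_lt_of_mem_idealBumps hab
    rw [labels, mem_union, mem_region] at hl
    rcases hl with hl | hl
    · refine ⟨fun h => by subst h; omega, fun h => h.2.2 ?_⟩
      have := regionIndex_mono (J := J) h.1.le
      exact (show regionIndex J a = regionIndex J l by omega)
    · obtain ⟨j, hj, rfl⟩ := mem_image.1 hl
      have hjC := supported_subset_chosenColumns m hj
      rcases eq_or_lt_of_le (show m + 1 ≤ regionIndex J a from ha) with he | hlt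
      · -- the corners of region `m + 1` lie in later columns than the supported ones
        obtain ⟨i', j', hc, -, hb⟩ := mem_idealBumps_iff.1 hab
        rw [← he] at hc hb
        obtain ⟨b₀, hb₀, hI⟩ := mem_supported_iff.1 hj
        have hjj : j < j' := by
          by_contra hle
          exact hc.2.2.1 (hI.mono (le_of_isLeast_region hb₀ hc.1.ge) (not_lt.1 hle)
            hc.regionIndex_lt)
        have hlt := columnLabel_lt hjC hc.2.1 hjj
        rw [← hb] at hlt
        exact ⟨hlt.ne, fun h => lt_asymm hlt h.2.1⟩
      · exact ((ih _).1 (columnLabel_mem hjC)).2 a b hab hlt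
  · rintro ⟨hml, hl⟩
    rw [labels, mem_union, mem_region]
    by_cases he : regionIndex J l = m + 1
    · exact Or.inl he
    right
    have hl' : l ∈ labels I (m + 1) :=
      (ih l).2 ⟨by omega, fun a b hab ha => hl a b hab (by omega)⟩
    obtain ⟨j, hj, rfl⟩ := exists_columnLabel_eq hl'
    refine mem_image.2 ⟨j, ?_, rfl⟩
    obtain ⟨b₀, -, hb₀⟩ := exists_isLeast_region (J := J) (m := m + 1) hml
    refine mem_supported_iff.2 ⟨b₀, hb₀, ?_⟩
    by_contra hn
    obtain ⟨i', j', hc, -, hj'⟩ := exists_isCorner (regionIndex_of_isLeast hb₀) hj hn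
    have hr := regionIndex_rowLabel hc.1
    obtain ⟨h1, h2⟩ := hl _ _ (mem_idealBumps_of_isCorner hc) (by omega)
    rcases eq_or_lt_of_le hj' with rfl | hlt
    · exact h1 rfl
    · refine h2 ⟨lt_of_regionIndex_lt (J := J) (by omega), columnLabel_lt hc.2.1 hj hlt,
        fun h => ?_⟩
      have h : regionIndex J _ = regionIndex J _ := h
      omega

theorem exists_noncrossing_of_ideal (I : LowerSet (ParabolicRoot J)) :
    ∃ P ∈ noncrossing J, bumps P = idealBumps I := by
  obtain ⟨P, hP⟩ := exists_bumps_eq (idealBumps I)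
    (fun a b h => lt_of_regionIndex_lt (regionIndex_lt_of_mem_idealBumps h))
    (fun a b b' h h' => by
      obtain ⟨i, j, hc, ha, rfl⟩ := mem_idealBumps_iff.1 h
      obtain ⟨i', j', hc', ha', rfl⟩ := mem_idealBumps_iff.1 h'
      obtain rfl := rowLabel_inj hc.1 hc'.1 (ha.symm.trans ha')
      rw [hc.right_unique hc'])
    (fun a a' b h h' => by
      rcases lt_trichotomy (regionIndex J a) (regionIndex J a') with hlt | he | hlt
      · exact absurd rfl (((mem_labels_iff _ _).1 (mem_labels_of_mem_idealBumps h)).2 a' b h'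
          hlt).1
      · obtain ⟨i, j, hc, ha, hb⟩ := mem_idealBumps_iff.1 h
        obtain ⟨i', j', hc', ha', hb'⟩ := mem_idealBumps_iff.1 h'
        rw [← he] at hc' ha' hb'
        obtain rfl := columnLabel_injOn (mem_coe.2 hc.2.1) (mem_coe.2 hc'.2.1) (hb.symm.trans hb')
        rw [ha, ha', hc.left_unique hc']
      · exact absurd rfl (((mem_labels_iff _ _).1 (mem_labels_of_mem_idealBumps h')).2 a b h
          hlt).1)
  refine ⟨P, ⟨transversal_iff.2 fun a b hab => ?_, ?_, ?_⟩, hP⟩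
  · rw [hP] at hab
    exact (regionIndex_lt_of_mem_idealBumps hab).ne
  · rw [hP]
    intro i₁ i₂ j₁ j₂ hi hj h1 h2 h3
    by_contra hne
    push Not at hne
    exact (((mem_labels_iff _ _).1 (mem_labels_of_mem_idealBumps hi)).2 j₁ j₂ hj
      ((not_sameRegion_iff h1.le).1 hne.1)).2 ⟨h2, h3, fun h => hne.2 h.symm⟩
  · rw [hP]
    intro i₁ i₂ j₁ j₂ hi hj h1 h2 h3 hs
    obtain ⟨i, j, hc, ha, hb⟩ := mem_idealBumps_iff.1 hi
    obtain ⟨i', j', hc', ha', hb'⟩ := mem_idealBumps_iff.1 hj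
    have hs' : regionIndex J i₁ = regionIndex J j₁ := hs
    rw [← hs'] at hc' ha' hb'
    -- both label maps reverse the order, so the bumps from one region do not nest
    have hii : i' < i := by
      rcases lt_trichotomy i i' with hlt | rfl | hlt
      · exact absurd (rowLabel_lt hc.1 hc'.1 hlt) (by rw [← ha, ← ha']; exact not_lt.2 h1.le)
      · exact absurd (ha.trans ha'.symm) h1.ne
      · exact hlt
    have hjj : j' < j := by
      by_contra hle
      exact hii.ne (hc'.eq_of_le hc hii.le (not_lt.1 hle)).1.symm
    have := columnLabel_lt hc'.2.1 hc.2.1 hjj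
    rw [← hb, ← hb'] at this
    exact lt_asymm h3 this

/-! ### The construction of bumps from an ideal is bijective -/

/-- Two order ideals have the same roots in the rows of the regions `m, m + 1, …`. -/
def AgreeFrom (I I' : LowerSet (ParabolicRoot J)) (m : ℕ) : Prop :=
  ∀ i j, m ≤ regionIndex J i → (InIdeal I i j ↔ InIdeal I' i j)

theorem AgreeFrom.mono {m k : ℕ} (h : AgreeFrom I I' m) (hk : m ≤ k) : AgreeFrom I I' k :=
  fun i j hi => h i j (hk.trans hi)

theorem AgreeFrom.supported_eq {m : ℕ} (h : AgreeFrom I I' (m + 1)) :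
    supported I m = supported I' m := by
  ext j
  rw [mem_supported_iff, mem_supported_iff]
  refine exists_congr fun b => and_congr_right fun hb => h b j (regionIndex_of_isLeast hb).ge

theorem AgreeFrom.chosenColumns_eq {m : ℕ} (h : AgreeFrom I I' (m + 1)) :
    chosenColumns I m = chosenColumns I' m := by
  rw [chosenColumns, chosenColumns, h.supported_eq]

theorem AgreeFrom.columnLabel_eq (m : ℕ) : AgreeFrom I I' (m + 1) →
    columnLabel I m = columnLabel I' m := by
  refine region_induction (n := n) (fun m hm _ => ?_) (fun m ih h => ?_) m
  · ext j
    rw [columnLabel, columnLabel, if_neg (not_lt.2 hm), if_neg (not_lt.2 hm)]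
  · ext j
    rw [columnLabel, columnLabel, h.chosenColumns_eq, h.supported_eq, ih (h.mono (Nat.le_succ _))]

theorem AgreeFrom.isCorner_iff {m : ℕ} (h : AgreeFrom I I' m) {i j : Fin n} :
    IsCorner I m i j ↔ IsCorner I' m i j := by
  have key : ∀ {I I' : LowerSet (ParabolicRoot J)}, AgreeFrom I I' m → IsCorner I m i j →
      IsCorner I' m i j := by
    intro I I' h hc
    have hC := (h.mono (Nat.le_succ m)).chosenColumns_eq
    refine ⟨hc.1, hC ▸ hc.2.1, mt (h i j hc.1.ge).2 hc.2.2.1, fun i' j' hi' hj' hi hj hn => ?_⟩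
    exact hc.2.2.2 i' j' hi' (hC ▸ hj') hi hj (mt (h i' j' hi'.ge).1 hn)
  exact ⟨key h, key fun i j hi => (h i j hi).symm⟩

theorem AgreeFrom.mem_idealBumps_iff {m : ℕ} (h : AgreeFrom I I' m) {a b : Fin n}
    (ha : m ≤ regionIndex J a) : (a, b) ∈ idealBumps I ↔ (a, b) ∈ idealBumps I' := by
  rw [ParabolicCatalan.mem_idealBumps_iff, ParabolicCatalan.mem_idealBumps_iff,
    AgreeFrom.columnLabel_eq _ (h.mono (ha.trans (Nat.le_succ _)))]
  simp only [(h.mono ha).isCorner_iff]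

theorem idealBumps_injective :
    Function.Injective (idealBumps : LowerSet (ParabolicRoot J) → Set (Fin n × Fin n)) := by
  intro I I' h
  have key : ∀ m, AgreeFrom I I' m := by
    refine fun m => region_induction (n := n) (fun m hm i j hi => ?_) (fun m ih => ?_) m
    · have := regionIndex_lt (J := J) i
      omega
    have hcorner : ∀ {I I' : LowerSet (ParabolicRoot J)}, idealBumps I = idealBumps I' →
        AgreeFrom I I' (m + 1) → ∀ i j, IsCorner I m i j → IsCorner I' m i j := by
      intro I I' h ih i j hc
      have hb := mem_idealBumps_of_isCorner hc
      rw [h, mem_idealBumps_iff, regionIndex_rowLabel hc.1,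
        AgreeFrom.columnLabel_eq m ih] at hb
      obtain ⟨i', j', hc', hi, hj⟩ := hb
      obtain rfl := rowLabel_inj hc.1 hc'.1 hi
      have hjC := hc.2.1
      rw [ih.chosenColumns_eq] at hjC
      obtain rfl := columnLabel_injOn (mem_coe.2 hjC) (mem_coe.2 hc'.2.1) hj
      exact hc'
    intro i j hi
    rcases eq_or_lt_of_le hi with he | hlt
    · rw [inIdeal_iff_isCorner, inIdeal_iff_isCorner, ← he, ih.chosenColumns_eq]
      refine and_congr_right fun _ => forall_congr' fun i' => forall_congr' fun j' => ?_
      have : IsCorner I m i' j' ↔ IsCorner I' m i' j' :=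
        ⟨hcorner h ih i' j', hcorner h.symm (fun i j hi => (ih i j hi).symm) i' j'⟩
      rw [this]
    · exact ih i j hlt
  exact lowerSet_ext fun i j => key 0 i j (Nat.zero_le _)

/-- An order ideal can be changed in the rows of region `m` so as to have as corners there any
prescribed antichain in the chosen columns. The earlier rows are emptied. -/
theorem exists_ideal_with_corners (I : LowerSet (ParabolicRoot J)) (m : ℕ)
    (K : Fin n → Fin n → Prop)
    (hK : ∀ i j, K i j → regionIndex J i = m ∧ j ∈ chosenColumns I m)
    (hanti : ∀ i j i' j', K i j → K i' j' → i ≤ i' → j' ≤ j → i' = i ∧ j' = j) :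
    ∃ I' : LowerSet (ParabolicRoot J), AgreeFrom I I' (m + 1) ∧
      ∀ i j, IsCorner I' m i j ↔ K i j := by
  let p : Fin n → Fin n → Prop := fun i j =>
    (m < regionIndex J i ∧ InIdeal I i j) ∨
      (regionIndex J i = m ∧ j ∈ chosenColumns I m ∧ ∀ i' j', K i' j' → i ≤ i' → ¬ j' ≤ j)
  have hp : ∀ i j i' j', p i j → i ≤ i' → j' ≤ j → regionIndex J i' < regionIndex J j' →
      p i' j' := by
    rintro i j i' j' (⟨h1, h2⟩ | ⟨h1, h2, h3⟩) hi hj hlt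
    · exact Or.inl ⟨h1.trans_le (regionIndex_mono hi), h2.mono hi hj hlt⟩
    · have hmi := regionIndex_mono (J := J) hi
      by_cases he : regionIndex J i' = m
      · exact Or.inr ⟨he, mem_chosenColumns_of_le h2 hj (by omega),
          fun i'' j'' hk hi'' hj'' => h3 i'' j'' hk (hi.trans hi'') (hj''.trans hj)⟩
      · have hmj := regionIndex_mono (J := J) hj
        rcases mem_chosenColumns_iff.1 h2 with h2 | h2
        · omega
        · obtain ⟨b, hb, hI⟩ := mem_supported_iff.1 h2
          exact Or.inl ⟨by omega, hI.mono (le_of_isLeast_region hb (by omega)) hj hlt⟩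
  have hagree : AgreeFrom I (idealOf p hp) (m + 1) := by
    intro i j hi
    rw [inIdeal_idealOf]
    constructor
    · exact fun h => ⟨h.regionIndex_lt, Or.inl ⟨hi, h⟩⟩
    · rintro ⟨-, h | h⟩
      · exact h.2
      · omega
  have hrow : ∀ i j, regionIndex J i = m → j ∈ chosenColumns I m →
      (¬ InIdeal (idealOf p hp) i j ↔ ∃ i' j', K i' j' ∧ i ≤ i' ∧ j' ≤ j) := by
    intro i j hi hj
    have hlt := regionIndex_of_mem_chosenColumns hj
    rw [inIdeal_idealOf]
    constructor
    · intro h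
      by_contra hne
      exact h ⟨by omega, Or.inr ⟨hi, hj, fun i' j' hk h1 h2 => hne ⟨i', j', hk, h1, h2⟩⟩⟩
    · rintro ⟨i', j', hk, h1, h2⟩ ⟨-, h | h⟩
      · omega
      · exact h.2.2 i' j' hk h1 h2
  refine ⟨idealOf p hp, hagree, fun i j => ?_⟩
  rw [IsCorner, ← hagree.chosenColumns_eq]
  constructor
  · rintro ⟨h1, h2, h3, h4⟩
    obtain ⟨i', j', hk, hi, hj⟩ := (hrow i j h1 h2).1 h3
    obtain ⟨h5, h6⟩ := hK i' j' hk
    obtain ⟨rfl, rfl⟩ := h4 i' j' h5 h6 hi hj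
      ((hrow i' j' h5 h6).2 ⟨i', j', hk, le_rfl, le_rfl⟩)
    exact hk
  · intro hk
    obtain ⟨h1, h2⟩ := hK i j hk
    refine ⟨h1, h2, (hrow i j h1 h2).2 ⟨i, j, hk, le_rfl, le_rfl⟩, fun i' j' hi' hj' hi hj hn => ?_⟩
    obtain ⟨i'', j'', hk', hi'', hj''⟩ := (hrow i' j' hi' hj').1 hn
    obtain ⟨rfl, rfl⟩ := hanti i j i'' j'' hk hk' (hi.trans hi'') (hj''.trans hj)
    exact ⟨le_antisymm hi'' hi, le_antisymm hj hj''⟩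

theorem exists_ideal_of_noncrossing {P : Finpartition (univ : Finset (Fin n))}
    (hP : P ∈ noncrossing J) : ∃ I : LowerSet (ParabolicRoot J), idealBumps I = bumps P := by
  have hcross : ∀ a b, (a, b) ∈ bumps P → regionIndex J a < regionIndex J b := fun a b hab =>
    (not_sameRegion_iff (bumps_lt hab).le).1 (transversal_iff.1 hP.1 a b hab)
  have key : ∀ m, ∃ I : LowerSet (ParabolicRoot J), ∀ a b, m ≤ regionIndex J a →
      ((a, b) ∈ idealBumps I ↔ (a, b) ∈ bumps P) := by
    refine fun m => region_induction (n := n) (fun m hm => ⟨⊥, fun a b ha => ?_⟩)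
      (fun m ih => ?_) m
    · have := regionIndex_lt (J := J) a
      omega
    obtain ⟨I, hI⟩ := ih
    obtain ⟨I', hagree, hcorner⟩ := exists_ideal_with_corners I m
      (fun i j => regionIndex J i = m ∧ j ∈ chosenColumns I m ∧
        (rowLabel J m i, columnLabel I m j) ∈ bumps P) (fun i j h => ⟨h.1, h.2.1⟩) (by
      rintro i j i' j' ⟨h1, h2, h3⟩ ⟨h1', h2', h3'⟩ hi hj
      rcases eq_or_lt_of_le hi with rfl | hi
      · exact ⟨rfl, columnLabel_injOn (mem_coe.2 h2') (mem_coe.2 h2)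
          (bumps_right_unique h3' h3)⟩
      rcases eq_or_lt_of_le hj with rfl | hj
      · exact ⟨rowLabel_inj h1' h1 (bumps_left_unique h3' h3), rfl⟩
      exact absurd (show SameRegion J _ _ from
        (regionIndex_rowLabel h1').trans (regionIndex_rowLabel h1).symm)
        (hP.2.2 _ _ _ _ h3' h3 (rowLabel_lt h1 h1' hi) (bumps_lt h3) (columnLabel_lt h2' h2 hj)))
    have hlater : ∀ a b, m < regionIndex J a → ((a, b) ∈ idealBumps I' ↔ (a, b) ∈ bumps P) :=
      fun a b ha => (hagree.mem_idealBumps_iff ha).symm.trans (hI a b ha)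
    refine ⟨I', fun a b ha => ?_⟩
    rcases eq_or_lt_of_le ha with he | hlt
    · constructor
      · intro hab
        obtain ⟨i, j, hc, ha', hb⟩ := mem_idealBumps_iff.1 hab
        rw [← he] at hc ha' hb
        rw [← AgreeFrom.columnLabel_eq m hagree] at hb
        rw [ha', hb]
        exact ((hcorner i j).1 hc).2.2
      · intro hab
        obtain ⟨i, hi, rfl⟩ := exists_rowLabel_eq he.symm
        have hb : b ∈ labels I' m := by
          refine (mem_labels_iff m b).2 ⟨by have := hcross _ _ hab; omega,
            fun a' b' hab' ha' => ⟨?_, ?_⟩⟩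
          · rintro rfl
            rw [hlater a' b' ha'] at hab'
            have := bumps_left_unique hab hab'
            subst this
            omega
          · rintro ⟨h1, h2, h3⟩
            have hlt : regionIndex J (rowLabel J m i) < regionIndex J a' := by omega
            rcases hP.2.1 _ _ _ _ hab ((hlater a' b' ha').1 hab') (lt_of_regionIndex_lt hlt) h1 h2
              with h | h
            · exact hlt.ne h
            · exact h3 h.symm
        obtain ⟨j, hj, rfl⟩ := exists_columnLabel_eq hb
        refine mem_idealBumps_of_isCorner ((hcorner i j).2 ⟨hi, ?_, ?_⟩)
        · rwa [hagree.chosenColumns_eq]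
        · rwa [AgreeFrom.columnLabel_eq m hagree]
    · exact hlater a b hlt
  obtain ⟨I, hI⟩ := key 0
  exact ⟨I, Set.ext fun ⟨a, b⟩ => hI a b (Nat.zero_le _)⟩

end

/-! ### The three bijections -/

section
variable {n : ℕ} (J : Set (Equiv.Perm (Fin n)))

theorem exists_equiv_avoiding231_noncrossing :
    ∃ φ : avoiding231 J ≃ noncrossing J, ∀ w, bumps (φ w).1 = des w.1 := by
  choose f hf hbumps using fun w : avoiding231 J => exists_noncrossing_of_mem_avoiding231 w.2
  refine ⟨Equiv.ofBijective (fun w => ⟨f w, hf w⟩) ⟨fun w w' h => ?_, fun P => ?_⟩, hbumps⟩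
  · refine Subtype.ext (eq_of_des_eq w.2 w'.2 ?_)
    exact (hbumps _).symm.trans ((congrArg (fun P => bumps P.1) h).trans (hbumps _))
  · obtain ⟨w, hw, hdes⟩ := exists_avoiding231_of_noncrossing P.2
    exact ⟨⟨w, hw⟩, Subtype.ext (bumps_injective ((hbumps ⟨w, hw⟩).trans hdes))⟩

theorem exists_equiv_nonnesting_lowerSet :
    ∃ ι : nonnesting J ≃ LowerSet (ParabolicRoot J), ∀ Q, bumps Q.1 = minimalComplement (ι Q) := by
  choose f hf using fun Q : nonnesting J => exists_ideal_of_nonnesting Q.2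
  refine ⟨Equiv.ofBijective f ⟨fun Q Q' h => ?_, fun I => ?_⟩, hf⟩
  · exact Subtype.ext (bumps_injective ((hf Q).trans (h ▸ (hf Q').symm)))
  · obtain ⟨Q, hQ, hb⟩ := exists_nonnesting_of_ideal I
    exact ⟨⟨Q, hQ⟩, minimalComplement_injective ((hf ⟨Q, hQ⟩).symm.trans hb)⟩

theorem exists_equiv_lowerSet_noncrossing :
    ∃ β : LowerSet (ParabolicRoot J) ≃ noncrossing J, ∀ I, bumps (β I).1 = idealBumps I := by
  choose f hf hbumps using fun I : LowerSet (ParabolicRoot J) => exists_noncrossing_of_ideal I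
  refine ⟨Equiv.ofBijective (fun I => ⟨f I, hf I⟩) ⟨fun I I' h => ?_, fun P => ?_⟩, hbumps⟩
  · refine idealBumps_injective ?_
    exact (hbumps _).symm.trans ((congrArg (fun P => bumps P.1) h).trans (hbumps _))
  · obtain ⟨I, hI⟩ := exists_ideal_of_noncrossing P.2
    exact ⟨I, Subtype.ext (bumps_injective ((hbumps I).trans hI))⟩

end

end ParabolicCatalan

theorem theorem1p2 (n : ℕ) (hn : 0 < n) (J : Set (Equiv.Perm (Fin n)))
    (hJ : J ⊆ ParabolicCatalan.adjacentTranspositions n) :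
    ∃ (φ : ↥(ParabolicCatalan.avoiding231 J) ≃ ↥(ParabolicCatalan.noncrossing J))
      (ψ : ↥(ParabolicCatalan.noncrossing J) ≃ ↥(ParabolicCatalan.nonnesting J))
      (ι : ↥(ParabolicCatalan.nonnesting J) ≃ LowerSet (ParabolicCatalan.ParabolicRoot J)),
      (∀ w, ParabolicCatalan.bumps (φ w).1 = ParabolicCatalan.des w.1) ∧
      (∀ P, ∀ j : Fin n, ((φ.symm P).1 j).val + 1 =
        ParabolicCatalan.recursiveWord J P.1 Finset.univ j) ∧
      (∀ Q, ParabolicCatalan.bumps Q.1 = ParabolicCatalan.minimalComplement (ι Q)) ∧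
      (∀ Q, ParabolicCatalan.bumps (ψ.symm Q).1 = ParabolicCatalan.idealBumps (ι Q)) := by
  obtain ⟨φ, hφ⟩ := ParabolicCatalan.exists_equiv_avoiding231_noncrossing J
  obtain ⟨ι, hι⟩ := ParabolicCatalan.exists_equiv_nonnesting_lowerSet J
  obtain ⟨β, hβ⟩ := ParabolicCatalan.exists_equiv_lowerSet_noncrossing J
  refine ⟨φ, (ι.trans β).symm, ι, hφ, fun P j => ?_, hι, fun Q => hβ (ι Q)⟩
  have hP := hφ (φ.symm P)
  rw [φ.apply_symm_apply] at hP
  exact (ParabolicCatalan.recursiveWord_eq_of_avoiding (φ.symm P).2 hP Finset.univ 0 n le_rfl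
    (by simp) (by simp) j (Finset.mem_univ _)).symm
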